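/- Let $0<\beta<\gamma<1$, $0\le\mu\le1$, $p>1/\beta$ and $x_0>0$. For $0<\alpha<1$ write $C^+_{\alpha}(0,\infty)$ for the set of nonnegative continuous functions $x$ on $(0,\infty)$ such that $t^{\alpha}x(t)$ extends to a nonnegative continuous function on $[0,\infty)$, and $L^p_{\mathrm{loc}}[0,\infty)$ for the functions that are $L^p$ on every bounded subinterval of $[0,\infty)$. Put $$I_{0^+}^{\alpha}\rho(t)=\frac1{\Gamma(\alpha)}\int_0^t\frac{\rho(s)}{(t-s)^{1-\alpha}}\,ds,\qquad D_{0^+}^{\beta}\rho(t)=\frac{d}{dt}I_{0^+}^{1-\beta}\rho(t).$$ Let $l$ be a nonnegative function on $(0,\infty)$ with $t^{(1-\mu)(1-\beta)}l(t)\in C(0,\infty)\cap L^p_{\mathrm{loc}}[0,\infty)$, and suppose that there is a constant $K\ge0$ with $t^{\gamma}l(t)\le K$ for all $t\in[1,\infty)$. Let $k$ be a nonnegative function on $(0,\infty)$ with $t^{1-\beta}k(t)\in C(0,\infty)\cap L^p_{\mathrm{loc}}[0,\infty)$ and $\lim_{t\to\infty}t^{\beta}k(t)=b\ge0$. Let $\phi$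 be a nonnegative continuous function on $[0,\infty)$, and suppose that there is a constant $M\ge0$ with $|\phi(u)|\le M u^{\mu}$ for all $u\in[0,\infty)$ (with the convention $0^0=1$). Then the Riemann–Liouville fractional initial value problem $$D_{0^+}^{\beta}x(t)=l(t)\,\phi(x(t))+k(t)\quad(t\in(0,\infty)),\qquad \lim_{t\to0^+}t^{1-\beta}x(t)=x_0,$$ has at least one solution $x\in C^+_{1-\beta}(0,\infty)$ with $$\lim_{t\to\infty}x(t)=\frac{b\pi}{\Gamma(\beta)\sin(\beta\pi)}.$$ Here a solution is a function $x$, integrable on $(0,T]$ for every $T>0$, such that for every $T>0$ the function $I_{0^+}^{1-\beta}x$ coincides on $(0,T]$ with an absolutely continuous function on $[0,T]$, the differential equation holds at every $t>0$, and the initial condition holds. -/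

import Mathlib

open Set Filter Topology MeasureTheory

/-- The Riemann-Liouville fractional integral of order `β`,
`I^β ρ (t) = 1 / Γ(β) * ∫₀ᵗ ρ(s) / (t - s)^(1 - β) ds`. -/
noncomputable def rlIntegral (β : ℝ) (ρ : ℝ → ℝ) (t : ℝ) : ℝ :=
  1 / Real.Gamma β * ∫ s in (0 : ℝ)..t, ρ s / (t - s) ^ (1 - β)

/-- `ρ` has Riemann-Liouville derivative `d` of order `β` at the point `t`: the function
`I^(1 - β) ρ` is differentiable at `t` with derivative `d`. -/
def HasRLDerivAt (β : ℝ) (ρ : ℝ → ℝ) (d t : ℝ) : Prop :=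
  HasDerivAt (rlIntegral (1 - β) ρ) d t

/-- The function `f`, regarded on `(0, ∞)`, is absolutely continuous up to `0`: for every `T > 0`
it agrees on `(0, T]` with an absolutely continuous function on `[0, T]`. -/
def IsAbsContUpToZero (f : ℝ → ℝ) : Prop :=
  ∀ T : ℝ, 0 < T → ∃ g : ℝ → ℝ, AbsolutelyContinuousOnInterval g 0 T ∧ EqOn g f (Ioc 0 T)

/-- The class `C⁺_α(0, ∞)` of nonnegative continuous functions `x` on `(0, ∞)` such that
`t ^ α * x t` belongs to `C⁺[0, ∞)`, that is, extends to a nonnegative continuous function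
on `[0, ∞)`. Values of `x` outside `(0, ∞)` play no role. -/
def CPlusWeighted (α : ℝ) : Set (ℝ → ℝ) :=
  {x | ContinuousOn x (Ioi 0) ∧ (∀ t, 0 < t → 0 ≤ x t) ∧
    ∃ g : ℝ → ℝ, ContinuousOn g (Ici 0) ∧ (∀ t, 0 ≤ t → 0 ≤ g t) ∧
      ∀ t, 0 < t → g t = t ^ α * x t}

/-- The class `L^p_loc[0, ∞)` for a real exponent `p`: functions that are `L^p` on every bounded
interval `[0, T]`. -/
def MemLpLoc (p : ℝ) (f : ℝ → ℝ) : Prop :=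
  ∀ T : ℝ, 0 < T → MemLp f (ENNReal.ofReal p) (volume.restrict (Icc 0 T))

/-- `x` solves the initial value problem
`D^β x (t) = l(t) φ(x(t)) + k(t)` for all `t > 0`, `lim_{t → 0+} t^(1 - β) x(t) = x₀`,
where `D^β` is the Riemann-Liouville derivative of order `β`: `x` is integrable on bounded
intervals (the domain of the fractional integral), `I^(1 - β) x` is absolutely continuous, the
equation holds at every point of `(0, ∞)`, and the initial condition holds. -/
structure IsRLSolution (β x₀ : ℝ) (l k φ : ℝ → ℝ) (x : ℝ → ℝ) : Prop where
  integrableOn : ∀ T : ℝ, 0 < T → IntegrableOn x (Ioc 0 T)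
  absCont : IsAbsContUpToZero (rlIntegral (1 - β) x)
  equation : ∀ t : ℝ, 0 < t → HasRLDerivAt β x (l t * φ (x t) + k t) t
  initial : Tendsto (fun t : ℝ => t ^ (1 - β) * x t) (𝓝[>] 0) (𝓝 x₀)

/-!
The function `u t = t ^ (1 - β) * x t` should solve the integral equation
`u t = x₀ + (1 / Γ(β)) * t ^ (1 - β) * ∫₀ᵗ (t - s) ^ (β - 1) * F s (u s) ds`, where
`F s u = l s * φ (s ^ (β - 1) * u) + k s` lies between `0` and `H s * (1 + u)` with
`s ^ (1 - β) * H s` in `L^p_loc`. Since `p > 1 / β`, Hölder's inequality leaves a gain `δ > 0`: even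
against the kernel `(t - s) ^ (β - δ - 1)` the integral of `H` converges. The gain bounds solutions
on `[0, T]` by a multiple of an exponential and makes them equicontinuous, so the solutions of the
equations with delay `1 / n`, which are explicit, have a limit point by the Arzelà-Ascoli theorem.
As `I^{1-β} I^β = I^1`, this limit point solves the differential equation.

At infinity, `∫₀ᵗ (t - s) ^ (β - 1) * s ^ (-β) ds = π / sin (β π)` for every `t`. The nonlinear
part of the right-hand side is `o(s ^ (-β)) * (1 + x s)`, so its Abel integral is absorbed in a
bound for `x`; once `x` is bounded, the whole right-hand side is `(b + o(1)) * s ^ (-β)`.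
-/

/-- The Abel integral `∫₀ᵗ (t - s) ^ (β - 1) * f s ds`, that is, the Riemann-Liouville integral
without its factor `1 / Γ(β)`. The integral over `Ioo 0 t` vanishes for `t ≤ 0`, so that the
integral operators below act on functions on the whole line. -/
noncomputable def abelIntegral (β : ℝ) (f : ℝ → ℝ) (t : ℝ) : ℝ :=
  ∫ s in Ioo 0 t, (t - s) ^ (β - 1) * f s

/-- The Abel integral of order `β` of `f` converges absolutely at every positive time. -/
def AbelIntegrable (β : ℝ) (f : ℝ → ℝ) : Prop :=
  ∀ t, 0 < t → IntegrableOn (fun s => (t - s) ^ (β - 1) * f s) (Ioo 0 t)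

section AbelIntegral

variable {α β γ t : ℝ} {f g H : ℝ → ℝ}

theorem rlIntegral_eq (ht : 0 ≤ t) : rlIntegral β f t = 1 / Real.Gamma β * abelIntegral β f t := by
  rw [rlIntegral, abelIntegral, intervalIntegral.integral_of_le ht, integral_Ioc_eq_integral_Ioo]
  congr 1
  refine setIntegral_congr_fun measurableSet_Ioo fun s hs => ?_
  rw [← neg_sub β 1, Real.rpow_neg (sub_nonneg.2 hs.2.le), div_inv_eq_mul, mul_comm]

theorem abelIntegral_of_nonpos (ht : t ≤ 0) : abelIntegral β f t = 0 := by
  rw [abelIntegral, Ioo_eq_empty (not_lt.2 ht), setIntegral_empty]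

theorem abelIntegral_one : abelIntegral 1 f t = ∫ s in Ioo 0 t, f s := by
  simp only [abelIntegral, sub_self, Real.rpow_zero, one_mul]

theorem abelIntegral_congr (h : EqOn f g (Ioo 0 t)) : abelIntegral β f t = abelIntegral β g t :=
  setIntegral_congr_fun measurableSet_Ioo fun s hs => by simp only [h hs]

theorem abelIntegral_nonneg (hf : ∀ s ∈ Ioo 0 t, 0 ≤ f s) : 0 ≤ abelIntegral β f t :=
  setIntegral_nonneg measurableSet_Ioo fun s hs =>
    mul_nonneg (Real.rpow_nonneg (sub_nonneg.2 hs.2.le) _) (hf s hs)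

theorem abelIntegral_const_mul (c : ℝ) :
    abelIntegral β (fun s => c * f s) t = c * abelIntegral β f t := by
  simp only [abelIntegral, mul_left_comm _ c, integral_const_mul]

theorem AbelIntegrable.const_mul (hf : AbelIntegrable β f) (c : ℝ) :
    AbelIntegrable β fun s => c * f s := fun t ht => by
  simp only [mul_left_comm _ c]
  exact (hf t ht).const_mul c

theorem AbelIntegrable.mono (hH : AbelIntegrable β H)
    (hf : AEStronglyMeasurable f (volume.restrict (Ioi 0)))
    (hfH : ∀ t, ∃ E, ∀ s ∈ Ioo 0 t, |f s| ≤ E * H s) : AbelIntegrable β f := by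
  intro t ht
  obtain ⟨E, hE⟩ := hfH t
  refine Integrable.mono' ((hH.const_mul E) t ht)
    ((Measurable.aestronglyMeasurable (by fun_prop)).mul
      (hf.mono_measure (Measure.restrict_mono Ioo_subset_Ioi_self le_rfl)))
    (ae_restrict_of_forall_mem measurableSet_Ioo fun s hs => ?_)
  have hk : 0 ≤ (t - s) ^ (β - 1) := Real.rpow_nonneg (sub_nonneg.2 hs.2.le) _
  rw [norm_mul, Real.norm_of_nonneg hk]
  exact mul_le_mul_of_nonneg_left (hE s hs) hk

theorem AbelIntegrable.mono_exponent (hf : AbelIntegrable β f) (h : β ≤ γ) :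
    AbelIntegrable γ f := by
  intro t ht
  have hbdd : ∀ᵐ s ∂volume.restrict (Ioo 0 t), ‖(t - s) ^ (γ - β)‖ ≤ t ^ (γ - β) := by
    refine ae_restrict_of_forall_mem measurableSet_Ioo fun s hs => ?_
    rw [Real.norm_of_nonneg (Real.rpow_nonneg (sub_nonneg.2 hs.2.le) _)]
    exact Real.rpow_le_rpow (sub_nonneg.2 hs.2.le) (by linarith [hs.1]) (by linarith)
  refine IntegrableOn.congr_fun (Integrable.bdd_mul (hf t ht)
    (Measurable.aestronglyMeasurable (by fun_prop)) hbdd) (fun s hs => ?_) measurableSet_Ioo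
  rw [← mul_assoc, ← Real.rpow_add (sub_pos.2 hs.2)]
  ring_nf

theorem AbelIntegrable.integrableOn (hf : AbelIntegrable β f) (hβ : β ≤ 1) (ht : 0 < t) :
    IntegrableOn f (Ioo 0 t) := by
  simpa only [sub_self, Real.rpow_zero, one_mul] using hf.mono_exponent hβ t ht

theorem AbelIntegrable.add (hf : AbelIntegrable β f) (hg : AbelIntegrable β g) :
    AbelIntegrable β fun s => f s + g s := fun t ht => by
  simp only [mul_add]
  exact (hf t ht).add (hg t ht)

theorem abelIntegral_add (hf : AbelIntegrable β f) (hg : AbelIntegrable β g) :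
    abelIntegral β (fun s => f s + g s) t = abelIntegral β f t + abelIntegral β g t := by
  rcases le_or_gt t 0 with ht | ht
  · simp only [abelIntegral_of_nonpos ht, add_zero]
  · simp only [abelIntegral, mul_add]
    exact integral_add (hf t ht) (hg t ht)

theorem abelIntegral_rpow_sub_one (hα : 0 < α) (hβ : 0 < β) (ht : 0 < t) :
    abelIntegral α (fun s => s ^ (β - 1)) t =
      ProbabilityTheory.beta β α * t ^ (α + β - 1) := by
  have key := Complex.betaIntegral_scaled (β : ℂ) (α : ℂ) ht
  have hintegral : ∫ s in (0 : ℝ)..t, (s : ℂ) ^ ((β : ℂ) - 1) * ((t : ℂ) - s) ^ ((α : ℂ) - 1) =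
      (abelIntegral α (fun s => s ^ (β - 1)) t : ℝ) := by
    rw [intervalIntegral.integral_of_le ht.le, integral_Ioc_eq_integral_Ioo, abelIntegral,
      ← integral_complex_ofReal]
    refine setIntegral_congr_fun measurableSet_Ioo fun s hs => ?_
    rw [Complex.ofReal_mul, Complex.ofReal_cpow hs.1.le,
      Complex.ofReal_cpow (sub_nonneg.2 hs.2.le), mul_comm]
    push_cast
    rfl
  have hpow : (t : ℂ) ^ ((β : ℂ) + α - 1) = ((t ^ (α + β - 1) : ℝ) : ℂ) := by
    rw [Complex.ofReal_cpow ht.le, add_comm α]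
    push_cast
    rfl
  rw [hintegral, hpow] at key
  rw [ProbabilityTheory.beta_eq_betaIntegralReal β α hβ hα, mul_comm, ← Complex.re_ofReal_mul,
    ← key, Complex.ofReal_re]

theorem abelIntegrable_rpow_sub_one (hα : 0 < α) (hβ : 0 < β) :
    AbelIntegrable α fun s => s ^ (β - 1) := fun t ht => by
  refine not_imp_comm.1 integral_undef ?_
  rw [← abelIntegral, abelIntegral_rpow_sub_one hα hβ ht]
  exact (mul_pos (ProbabilityTheory.beta_pos hβ hα) (Real.rpow_pos_of_pos ht _)).ne'

end AbelIntegral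

section Semigroup

variable {α β t : ℝ} {f : ℝ → ℝ}

theorem AbelIntegrable.aestronglyMeasurable (hf : AbelIntegrable β f) :
    AEStronglyMeasurable f (volume.restrict (Ioi 0)) := by
  have hunion : Ioi (0 : ℝ) = ⋃ n : ℕ, Ioo 0 ((n : ℝ) + 1) := by
    ext s
    simp only [mem_Ioi, mem_iUnion, mem_Ioo, exists_and_left, iff_self_and]
    exact fun _ => (exists_nat_gt s).imp fun n hn => hn.trans (lt_add_one _)
  rw [hunion, aestronglyMeasurable_iUnion_iff]
  intro n
  set t : ℝ := n + 1
  have hinv : AEStronglyMeasurable (fun s => (t - s) ^ (1 - β)) (volume.restrict (Ioo 0 t)) :=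
    Measurable.aestronglyMeasurable (by fun_prop)
  refine (hinv.mul (hf t (by positivity)).aestronglyMeasurable).congr
    (ae_restrict_of_forall_mem measurableSet_Ioo fun s hs => ?_)
  simp only [Pi.mul_apply]
  rw [← mul_assoc, ← Real.rpow_add (sub_pos.2 hs.2), sub_add_sub_cancel, sub_self,
    Real.rpow_zero, one_mul]

theorem indicator_Ioi_mul_indicator_Ioi_sub (f g : ℝ → ℝ) (t : ℝ) :
    (fun s => (Ioi 0).indicator f s * (Ioi 0).indicator g (t - s)) =
      (Ioo 0 t).indicator fun s => g (t - s) * f s := by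
  funext s
  simp only [indicator_apply, mem_Ioi, mem_Ioo, sub_pos]
  grind

theorem abelIntegral_eq_convolution :
    abelIntegral β f = convolution ((Ioi 0).indicator f) ((Ioi 0).indicator fun s => s ^ (β - 1))
      (ContinuousLinearMap.mul ℝ ℝ) volume := by
  funext t
  simp only [convolution, ContinuousLinearMap.mul_apply', abelIntegral,
    indicator_Ioi_mul_indicator_Ioi_sub, integral_indicator measurableSet_Ioo]

theorem AbelIntegrable.convolutionExistsAt (hf : AbelIntegrable β f) (t : ℝ) :
    ConvolutionExistsAt ((Ioi 0).indicator f) ((Ioi 0).indicator fun s => s ^ (β - 1)) t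
      (ContinuousLinearMap.mul ℝ ℝ) volume := by
  simp only [ConvolutionExistsAt, ContinuousLinearMap.mul_apply',
    indicator_Ioi_mul_indicator_Ioi_sub, integrable_indicator_iff measurableSet_Ioo]
  rcases le_or_gt t 0 with ht | ht
  · rw [Ioo_eq_empty (not_lt.2 ht)]
    exact integrableOn_empty
  · exact hf t ht

theorem AbelIntegrable.abs (hf : AbelIntegrable β f) : AbelIntegrable β fun s => |f s| :=
  fun t ht => by
    refine IntegrableOn.congr_fun (hf t ht).norm (fun s hs => ?_) measurableSet_Ioo
    rw [norm_mul, Real.norm_of_nonneg (Real.rpow_nonneg (sub_nonneg.2 hs.2.le) _),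
      Real.norm_eq_abs]

theorem convolution_rpow_sub_one (hα : 0 < α) (hβ : 0 < β) :
    convolution ((Ioi 0).indicator fun s => s ^ (β - 1)) ((Ioi 0).indicator fun s => s ^ (α - 1))
        (ContinuousLinearMap.mul ℝ ℝ) volume =
      ProbabilityTheory.beta β α • (Ioi 0).indicator fun s => s ^ (α + β - 1) := by
  funext t
  rw [← abelIntegral_eq_convolution, Pi.smul_apply, smul_eq_mul]
  rcases le_or_gt t 0 with ht | ht
  · rw [abelIntegral_of_nonpos ht, indicator_of_notMem (notMem_Ioi.2 ht), mul_zero]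
  · rw [abelIntegral_rpow_sub_one hα hβ ht, indicator_of_mem (mem_Ioi.2 ht)]

theorem abelIntegral_abelIntegral (hα : 0 < α) (hβ : 0 < β) (hf : AbelIntegrable β f) :
    abelIntegral α (abelIntegral β f) t =
      ProbabilityTheory.beta β α * abelIntegral (α + β) f t := by
  have hmeas : ∀ a : ℝ, AEStronglyMeasurable ((Ioi 0).indicator fun s : ℝ => s ^ (a - 1)) :=
    fun a => (Measurable.indicator (by fun_prop) measurableSet_Ioi).aestronglyMeasurable
  have hnorm : ∀ a : ℝ, (fun x => ‖(Ioi 0).indicator (fun s : ℝ => s ^ (a - 1)) x‖) =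
      (Ioi 0).indicator fun s : ℝ => s ^ (a - 1) := fun a => funext fun x =>
    Real.norm_of_nonneg (indicator_nonneg (fun s hs => Real.rpow_nonneg (le_of_lt hs) _) x)
  have hsupp : (Ioi 0).indicator (abelIntegral β f) = abelIntegral β f :=
    indicator_eq_self.2 fun s hs => not_le.1 fun h => hs (abelIntegral_of_nonpos h)
  have hassoc := convolution_assoc (ContinuousLinearMap.mul ℝ ℝ) (ContinuousLinearMap.mul ℝ ℝ)
    (ContinuousLinearMap.mul ℝ ℝ) (ContinuousLinearMap.mul ℝ ℝ) mul_assoc (x₀ := t)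
    ((aestronglyMeasurable_indicator_iff measurableSet_Ioi).2 hf.aestronglyMeasurable)
    (hmeas β) (hmeas α) (Eventually.of_forall hf.convolutionExistsAt)
    (by
      rw [hnorm, hnorm]
      exact Eventually.of_forall (abelIntegrable_rpow_sub_one hα hβ).convolutionExistsAt)
    (by
      rw [hnorm, hnorm, convolution_rpow_sub_one hα hβ]
      simp only [norm_indicator_eq_indicator_norm]
      have h := (hf.abs.mono_exponent (le_add_of_nonneg_left hα.le)).convolutionExistsAt t
      exact (h.smul (ProbabilityTheory.beta β α)).congr (Eventually.of_forall fun s =>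
        mul_left_comm _ _ _))
  rw [convolution_rpow_sub_one hα hβ, convolution_smul, ← abelIntegral_eq_convolution,
    ← abelIntegral_eq_convolution, ← hsupp, ← abelIntegral_eq_convolution] at hassoc
  exact hassoc

end Semigroup

section Asymptotics

variable {β S t : ℝ} {f y : ℝ → ℝ}

theorem abelIntegrable_rpow_neg (hβ : 0 < β) (hβ1 : β < 1) :
    AbelIntegrable β fun s => s ^ (-β) := by
  simpa only [sub_sub_cancel_left] using abelIntegrable_rpow_sub_one hβ (sub_pos.2 hβ1)

theorem abelIntegral_rpow_neg (hβ : 0 < β) (hβ1 : β < 1) (ht : 0 < t) :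
    abelIntegral β (fun s => s ^ (-β)) t = ProbabilityTheory.beta (1 - β) β := by
  have h := abelIntegral_rpow_sub_one hβ (sub_pos.2 hβ1) ht
  rwa [add_sub_cancel, sub_self, Real.rpow_zero, mul_one, sub_sub_cancel_left] at h

theorem beta_one_sub_self (β : ℝ) :
    ProbabilityTheory.beta (1 - β) β = Real.pi / Real.sin (Real.pi * β) := by
  rw [ProbabilityTheory.beta, sub_add_cancel, Real.Gamma_one, div_one, mul_comm,
    Real.Gamma_mul_Gamma_one_sub]

theorem abs_abelIntegral_le_of_tail_le {E : ℝ} (hβ : 0 < β) (hβ1 : β < 1)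
    (hf : AbelIntegrable β f) (hS : 0 < S) (hSt : S < t) (hE : 0 ≤ E)
    (htail : ∀ s ∈ Ico S t, |f s| ≤ E * s ^ (-β)) :
    |abelIntegral β f t| ≤
      (t - S) ^ (β - 1) * (∫ s in Ioo 0 S, |f s|) + E * ProbabilityTheory.beta (1 - β) β := by
  have ht : 0 < t := hS.trans hSt
  have hhead : IntegrableOn ((Ioo 0 S).indicator fun s => |f s|) (Ioo 0 t) :=
    ((integrable_indicator_iff measurableSet_Ioo).2
      (hf.integrableOn hβ1.le hS).abs).integrableOn
  have hpow := abelIntegrable_rpow_neg hβ hβ1 t ht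
  have hpt : ∀ s ∈ Ioo 0 t, ‖(t - s) ^ (β - 1) * f s‖ ≤
      (t - S) ^ (β - 1) * (Ioo 0 S).indicator (fun s => |f s|) s +
        E * ((t - s) ^ (β - 1) * s ^ (-β)) := by
    intro s hs
    have hk : 0 ≤ (t - s) ^ (β - 1) := Real.rpow_nonneg (sub_nonneg.2 hs.2.le) _
    have hs' : 0 ≤ s ^ (-β) := Real.rpow_nonneg hs.1.le _
    rw [norm_mul, Real.norm_of_nonneg hk, Real.norm_eq_abs]
    rcases lt_or_ge s S with h | h
    · rw [indicator_of_mem (show s ∈ Ioo 0 S from ⟨hs.1, h⟩)]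
      refine le_add_of_le_of_nonneg (mul_le_mul_of_nonneg_right ?_ (abs_nonneg _)) (by positivity)
      exact Real.rpow_le_rpow_of_nonpos (by linarith) (by linarith) (by linarith)
    · rw [indicator_of_notMem (fun hm => absurd hm.2 (not_lt.2 h)), mul_zero, zero_add,
        mul_left_comm]
      exact mul_le_mul_of_nonneg_left (htail s ⟨h, hs.2⟩) hk
  calc |abelIntegral β f t|
      ≤ ∫ s in Ioo 0 t, ((t - S) ^ (β - 1) * (Ioo 0 S).indicator (fun s => |f s|) s +
          E * ((t - s) ^ (β - 1) * s ^ (-β))) :=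
        norm_integral_le_of_norm_le ((hhead.const_mul _).add (hpow.const_mul E))
          (ae_restrict_of_forall_mem measurableSet_Ioo hpt)
    _ = _ := by
        rw [integral_add (hhead.const_mul _) (hpow.const_mul E), integral_const_mul,
          integral_const_mul, setIntegral_indicator measurableSet_Ioo,
          inter_eq_right.2 (Ioo_subset_Ioo_right hSt.le), ← abelIntegral_rpow_neg hβ hβ1 ht,
          abelIntegral]

theorem tendsto_abelIntegral_atTop_zero (hβ : 0 < β) (hβ1 : β < 1) (hf : AbelIntegrable β f)
    (h : Tendsto (fun t => t ^ β * f t) atTop (𝓝 0)) :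
    Tendsto (abelIntegral β f) atTop (𝓝 0) := by
  have hA : 0 < ProbabilityTheory.beta (1 - β) β :=
    ProbabilityTheory.beta_pos (sub_pos.2 hβ1) hβ
  set A := ProbabilityTheory.beta (1 - β) β
  rw [Metric.tendsto_nhds]
  intro ε hε
  have htail : ∀ᶠ s in atTop, 0 < s ∧ |f s| ≤ ε / (2 * A) * s ^ (-β) := by
    filter_upwards [eventually_gt_atTop 0,
      Metric.tendsto_nhds.1 h (ε / (2 * A)) (by positivity)] with s hs hfs
    rw [Real.dist_0_eq_abs, abs_mul, abs_of_pos (Real.rpow_pos_of_pos hs β)] at hfs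
    refine ⟨hs, ?_⟩
    rw [Real.rpow_neg hs.le, ← div_eq_mul_inv, le_div_iff₀' (Real.rpow_pos_of_pos hs β)]
    exact hfs.le
  obtain ⟨S, hS⟩ := htail.exists_forall_of_atTop
  have hhead : Tendsto (fun t : ℝ => (t - S) ^ (β - 1) * ∫ s in Ioo 0 S, |f s|) atTop (𝓝 0) := by
    have h := (tendsto_rpow_neg_atTop (sub_pos.2 hβ1)).comp
      (tendsto_atTop_add_const_right atTop (-S) tendsto_id)
    simpa only [neg_sub, zero_mul, Function.comp_def, id, ← sub_eq_add_neg] using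
      h.mul_const (∫ s in Ioo 0 S, |f s|)
  filter_upwards [hhead.eventually_lt_const (half_pos hε), eventually_gt_atTop S] with t ht hSt
  have hle := abs_abelIntegral_le_of_tail_le hβ hβ1 hf (hS S le_rfl).1 hSt (by positivity)
    fun s hs => (hS s hs.1).2
  rw [div_mul_eq_mul_div, mul_div_mul_right _ _ hA.ne'] at hle
  rw [Real.dist_0_eq_abs]
  linarith

theorem tendsto_abelIntegral_atTop {b : ℝ} (hβ : 0 < β) (hβ1 : β < 1) (hf : AbelIntegrable β f)
    (h : Tendsto (fun t => t ^ β * f t) atTop (𝓝 b)) :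
    Tendsto (abelIntegral β f) atTop (𝓝 (b * ProbabilityTheory.beta (1 - β) β)) := by
  have hpow := (abelIntegrable_rpow_neg hβ hβ1).const_mul (-b)
  have hzero : Tendsto (fun t => t ^ β * (f t + -b * t ^ (-β))) atTop (𝓝 0) := by
    refine Tendsto.congr' ?_ (by simpa only [add_neg_cancel] using h.add_const (-b))
    filter_upwards [eventually_gt_atTop 0] with t ht
    have hone : t ^ β * t ^ (-β) = 1 := by rw [← Real.rpow_add ht, add_neg_cancel, Real.rpow_zero]
    linear_combination b * hone
  have hlim := (tendsto_abelIntegral_atTop_zero hβ hβ1 (hf.add hpow) hzero).add_const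
    (b * ProbabilityTheory.beta (1 - β) β)
  rw [zero_add] at hlim
  refine hlim.congr' ?_
  filter_upwards [eventually_gt_atTop 0] with t ht
  rw [abelIntegral_add hf hpow, abelIntegral_const_mul, abelIntegral_rpow_neg hβ hβ1 ht]
  ring

theorem exists_forall_le_of_running_max {S' m : ℝ} (hyc : ContinuousOn y (Ici S)) (hS : S ≤ S')
    (h : ∀ t, S' ≤ t → (∀ s ∈ Icc S t, y s ≤ y t) → y t ≤ m) : ∃ B, ∀ t, S ≤ t → y t ≤ B := by
  have hmax : ∀ t, S ≤ t → ∃ s ∈ Icc S t, ∀ r ∈ Icc S t, y r ≤ y s := fun t ht =>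
    isCompact_Icc.exists_isMaxOn (nonempty_Icc.2 ht) (hyc.mono Icc_subset_Ici_self)
  obtain ⟨s₁, -, hs₁⟩ := hmax S' hS
  refine ⟨max (y s₁) m, fun t ht => ?_⟩
  obtain ⟨s, hs, hst⟩ := hmax t ht
  refine (hst t ⟨ht, le_rfl⟩).trans ?_
  rcases le_total s S' with hsS | hsS
  · exact le_max_of_le_left (hs₁ s ⟨hs.1, hsS⟩)
  · exact le_max_of_le_right (h s hsS fun r hr => hst r ⟨hr.1, hr.2.trans hs.2⟩)

theorem exists_eventually_le_of_le_abelIntegral {a c : ℝ} (hβ : 0 < β) (hβ1 : β < 1)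
    (hc : 0 ≤ c) (hyc : ContinuousOn y (Ioi 0)) (hy0 : ∀ t, 0 < t → 0 ≤ y t)
    (hf : AbelIntegrable β f) (hy : ∀ᶠ t in atTop, y t ≤ a + c * abelIntegral β f t)
    (hfy : ∀ η, 0 < η → ∃ C, ∀ᶠ s in atTop, |f s| ≤ (η * y s + C) * s ^ (-β)) :
    ∃ B, ∀ᶠ t in atTop, y t ≤ B := by
  have hA : 0 < ProbabilityTheory.beta (1 - β) β :=
    ProbabilityTheory.beta_pos (sub_pos.2 hβ1) hβ
  set A := ProbabilityTheory.beta (1 - β) β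
  obtain ⟨η, hη, hηA⟩ : ∃ η, 0 < η ∧ c * (η * A) ≤ 1 / 2 := by
    refine ⟨1 / (2 * (c + 1) * A), by positivity, ?_⟩
    rw [show c * (1 / (2 * (c + 1) * A) * A) = c / (c + 1) / 2 by field_simp]
    linarith [(div_le_one (by linarith : 0 < c + 1)).2 (by linarith : c ≤ c + 1)]
  obtain ⟨C, hC⟩ := hfy η hη
  obtain ⟨S, hS⟩ := ((eventually_gt_atTop 0).and (hy.and hC)).exists_forall_of_atTop
  have hS0 : 0 < S := (hS S le_rfl).1
  set I := ∫ s in Ioo 0 S, |f s|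
  have hI : 0 ≤ I := integral_nonneg fun _ => abs_nonneg _
  have hstep : ∀ t, S + 1 ≤ t → (∀ s ∈ Icc S t, y s ≤ y t) →
      y t ≤ 2 * (a + c * (I + |C| * A)) := by
    intro t ht hmax
    have hyt := hy0 t (by linarith)
    have h := (le_abs_self _).trans (abs_abelIntegral_le_of_tail_le hβ hβ1 hf hS0
      (show S < t by linarith) (show 0 ≤ η * y t + |C| by positivity) fun s hs =>
        (hS s hs.1).2.2.trans (mul_le_mul_of_nonneg_right
          (add_le_add (mul_le_mul_of_nonneg_left (hmax s ⟨hs.1, hs.2.le⟩) hη.le) (le_abs_self C))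
          (Real.rpow_nonneg (hS0.le.trans hs.1) _)))
    have hhead : (t - S) ^ (β - 1) * I ≤ I := mul_le_of_le_one_left hI
      (Real.rpow_le_one_of_one_le_of_nonpos (by linarith) (by linarith))
    have hyle : y t ≤ a + c * (I + |C| * A) + c * (η * A) * y t := by
      calc y t ≤ a + c * (I + (η * y t + |C|) * A) :=
            (hS t (by linarith)).2.1.trans (by gcongr; exact h.trans (by gcongr))
        _ = _ := by ring
    linarith [mul_le_mul_of_nonneg_right hηA hyt]
  obtain ⟨B, hB⟩ := exists_forall_le_of_running_max
    (hyc.mono fun s hs => hS0.trans_le hs) (lt_add_one S).le hstep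
  exact ⟨B, (eventually_ge_atTop S).mono hB⟩

end Asymptotics

/-- The integral operator `t ^ (1 - β) * ∫₀ᵗ (t - s) ^ (β - 1) * f s ds` of the equation satisfied
by the weighted unknown `t ^ (1 - β) * x t`. -/
noncomputable def weightedAbelIntegral (β : ℝ) (f : ℝ → ℝ) (t : ℝ) : ℝ :=
  t ^ (1 - β) * abelIntegral β f t

/-- `H` is a nonnegative weight on `(0, ∞)` whose Abel integral converges, and is of size
`C t * t ^ (β - 1 + δ)`, even for the kernel `(t - s) ^ (β - 1 - δ)`, which is more singular by `δ`
than that of order `β`. The exponent `δ` is what is gained in the Hölder and exponential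
estimates. -/
structure AbelWeight (β δ : ℝ) (H C : ℝ → ℝ) : Prop where
  order_pos : 0 < β
  order_le_one : β ≤ 1
  gain_pos : 0 < δ
  gain_le_one : δ ≤ 1
  nonneg : ∀ s, 0 < s → 0 ≤ H s
  abelIntegrable : AbelIntegrable (β - δ) H
  monotone : Monotone C
  abelIntegral_le : ∀ t, 0 < t → abelIntegral (β - δ) H t ≤ C t * t ^ (β - 1 + δ)

section KernelEstimates

variable {β δ s t t' x y : ℝ} {f H C : ℝ → ℝ}

theorem rpow_le_rpow_mul_rpow_sub {a : ℝ} (hδ : 0 ≤ δ) (hx : 0 < x) (hxy : x ≤ y) :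
    x ^ a ≤ y ^ δ * x ^ (a - δ) := by
  calc x ^ a = x ^ δ * x ^ (a - δ) := by rw [← Real.rpow_add hx, add_sub_cancel]
    _ ≤ y ^ δ * x ^ (a - δ) := by gcongr

theorem one_sub_rpow_le (hβ : 0 ≤ β) (hδ : δ ≤ 1) (hx0 : 0 < x) (hx : x ≤ 1) :
    1 - x ^ (1 - β) ≤ (1 - x) ^ δ := by
  have h1 : x ≤ x ^ (1 - β) := by
    simpa only [Real.rpow_one] using
      Real.rpow_le_rpow_of_exponent_ge hx0 hx (show 1 - β ≤ 1 by linarith)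
  have h2 : 1 - x ≤ (1 - x) ^ δ := Real.self_le_rpow_of_le_one (by linarith) (by linarith) hδ
  linarith

theorem rpow_sub_rpow_le (hβ : 0 ≤ β) (hδ0 : 0 ≤ δ) (hδ : δ ≤ 1) (hx : 0 < x) (hxy : x ≤ y) :
    x ^ (β - 1) - y ^ (β - 1) ≤ (y - x) ^ δ * x ^ (β - δ - 1) := by
  have hy : 0 < y := hx.trans_le hxy
  have hratio : (x / y) ^ (1 - β) = y ^ (β - 1) / x ^ (β - 1) := by
    rw [← neg_sub, Real.rpow_neg (by positivity), Real.div_rpow hx.le hy.le, inv_div]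
  have hle : 1 - (x / y) ^ (1 - β) ≤ ((y - x) / x) ^ δ := by
    refine (one_sub_rpow_le hβ hδ (by positivity) ((div_le_one hy).2 hxy)).trans ?_
    rw [one_sub_div hy.ne']
    exact Real.rpow_le_rpow (div_nonneg (by linarith) hy.le)
      (div_le_div_of_nonneg_left (by linarith) hx hxy) hδ0
  rw [hratio, Real.div_rpow (by linarith) hx.le] at hle
  calc x ^ (β - 1) - y ^ (β - 1) = x ^ (β - 1) * (1 - y ^ (β - 1) / x ^ (β - 1)) := by
        field_simp
    _ ≤ x ^ (β - 1) * ((y - x) ^ δ / x ^ δ) := by gcongr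
    _ = (y - x) ^ δ * x ^ (β - δ - 1) := by
        rw [sub_right_comm, Real.rpow_sub hx (β - 1) δ]
        ring

theorem weightedKernel_eq (ht : 0 < t) (hst : s ≤ t) :
    t ^ (1 - β) * (t - s) ^ (β - 1) = ((t - s) / t) ^ (β - 1) := by
  rw [Real.div_rpow (sub_nonneg.2 hst) ht.le, ← neg_sub β 1, Real.rpow_neg ht.le, div_eq_inv_mul]

theorem sub_div_self_sub_sub_div_self (ht : 0 < t) (ht' : 0 < t') :
    (t' - s) / t' - (t - s) / t = s / t' * ((t' - t) / t) := by
  field_simp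
  ring

theorem weightedKernel_antitone (hβ : β ≤ 1) (hs : 0 ≤ s) (hst : s < t) (htt' : t ≤ t') :
    t' ^ (1 - β) * (t' - s) ^ (β - 1) ≤ t ^ (1 - β) * (t - s) ^ (β - 1) := by
  have ht : 0 < t := hs.trans_lt hst
  have ht' : 0 < t' := ht.trans_le htt'
  rw [weightedKernel_eq ht hst.le, weightedKernel_eq ht' (hst.le.trans htt')]
  refine Real.rpow_le_rpow_of_nonpos (div_pos (sub_pos.2 hst) ht) ?_ (by linarith)
  rw [← sub_nonneg, sub_div_self_sub_sub_div_self ht ht']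
  exact mul_nonneg (div_nonneg hs ht'.le) (div_nonneg (sub_nonneg.2 htt') ht.le)

theorem weightedKernel_sub_le (hβ : 0 ≤ β) (hδ0 : 0 ≤ δ) (hδ : δ ≤ 1) (hs : 0 ≤ s) (hst : s < t)
    (htt' : t ≤ t') :
    t ^ (1 - β) * (t - s) ^ (β - 1) - t' ^ (1 - β) * (t' - s) ^ (β - 1) ≤
      (t' - t) ^ δ * (t ^ (1 - β) * (t - s) ^ (β - δ - 1)) := by
  have ht : 0 < t := hs.trans_lt hst
  have ht' : 0 < t' := ht.trans_le htt'
  have hinc : 0 ≤ (t' - t) / t := div_nonneg (sub_nonneg.2 htt') ht.le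
  have hnonneg : 0 ≤ s / t' * ((t' - t) / t) := mul_nonneg (div_nonneg hs ht'.le) hinc
  have hle : s / t' * ((t' - t) / t) ≤ (t' - t) / t :=
    mul_le_of_le_one_left hinc ((div_le_one ht').2 (hst.le.trans htt'))
  rw [weightedKernel_eq ht hst.le, weightedKernel_eq ht' (hst.le.trans htt')]
  have h := rpow_sub_rpow_le hβ hδ0 hδ (div_pos (sub_pos.2 hst) ht)
    (sub_nonneg.1 (by rwa [sub_div_self_sub_sub_div_self ht ht']))
  rw [sub_div_self_sub_sub_div_self ht ht'] at h
  calc _ ≤ _ := h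
    _ ≤ ((t' - t) / t) ^ δ * ((t - s) / t) ^ (β - δ - 1) := by
        have := sub_nonneg.2 hst.le
        gcongr
    _ = (t' - t) ^ δ * ((t ^ (-δ) * t ^ (-(β - δ - 1))) * (t - s) ^ (β - δ - 1)) := by
        rw [Real.div_rpow (sub_nonneg.2 htt') ht.le, Real.div_rpow (sub_nonneg.2 hst.le) ht.le,
          Real.rpow_neg ht.le, Real.rpow_neg ht.le]
        ring
    _ = _ := by
        rw [← Real.rpow_add ht]
        ring_nf

theorem exp_neg_le_rpow_neg (hδ0 : 0 ≤ δ) (hδ : δ ≤ 1) (hx : 0 < x) :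
    Real.exp (-x) ≤ x ^ (-δ) := by
  rw [Real.exp_neg, Real.rpow_neg hx.le]
  refine inv_anti₀ (Real.rpow_pos_of_pos hx _) ?_
  rcases le_total x 1 with h | h
  · exact (Real.rpow_le_one hx.le h hδ0).trans (Real.one_le_exp hx.le)
  · calc x ^ δ ≤ x := Real.rpow_le_self_of_one_le h hδ
      _ ≤ Real.exp x := by linarith [Real.add_one_le_exp x]

/- The kernel `exp (-λ (t - s))` is at most `(λ (t - s)) ^ (-δ)`, which trades the gain `δ` for
smallness in `λ`. -/
theorem abs_abelIntegral_le_exp {D r : ℝ} (hδ0 : 0 ≤ δ) (hδ : δ ≤ 1) (hr : 0 < r)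
    (hH : AbelIntegrable (β - δ) H) (hf : ∀ s ∈ Ioo 0 t, |f s| ≤ D * H s * Real.exp (r * s)) :
    |abelIntegral β f t| ≤ Real.exp (r * t) * r ^ (-δ) * D * abelIntegral (β - δ) H t := by
  rcases le_or_gt t 0 with ht | ht
  · simp only [abelIntegral_of_nonpos ht, abs_zero, mul_zero, le_refl]
  rw [← Real.norm_eq_abs, abelIntegral, abelIntegral, ← integral_const_mul]
  refine norm_integral_le_of_norm_le ((hH t ht).const_mul _)
    (ae_restrict_of_forall_mem measurableSet_Ioo fun s hs => ?_)
  have hts : 0 < t - s := sub_pos.2 hs.2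
  have hk := Real.rpow_pos_of_pos hts (β - 1)
  have hDH : 0 ≤ D * H s :=
    nonneg_of_mul_nonneg_left ((abs_nonneg _).trans (hf s hs)) (Real.exp_pos _)
  have hexp : Real.exp (r * s) ≤ Real.exp (r * t) * (r ^ (-δ) * (t - s) ^ (-δ)) := by
    rw [← Real.mul_rpow hr.le hts.le]
    calc Real.exp (r * s) = Real.exp (r * t) * Real.exp (-(r * (t - s))) := by
          rw [← Real.exp_add]
          ring_nf
      _ ≤ _ := by
          gcongr
          exact exp_neg_le_rpow_neg hδ0 hδ (mul_pos hr hts)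
  rw [norm_mul, Real.norm_of_nonneg hk.le, Real.norm_eq_abs]
  calc (t - s) ^ (β - 1) * |f s|
      ≤ (t - s) ^ (β - 1) * (D * H s * (Real.exp (r * t) * (r ^ (-δ) * (t - s) ^ (-δ)))) := by
        gcongr
        exact (hf s hs).trans (mul_le_mul_of_nonneg_left hexp hDH)
    _ = Real.exp (r * t) * r ^ (-δ) * D * (((t - s) ^ (β - 1) * (t - s) ^ (-δ)) * H s) := by ring
    _ = _ := by rw [← Real.rpow_add hts, ← sub_eq_add_neg, sub_right_comm]

theorem weightedAbelIntegral_of_nonpos (ht : t ≤ 0) : weightedAbelIntegral β f t = 0 := by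
  rw [weightedAbelIntegral, abelIntegral_of_nonpos ht, mul_zero]

theorem setIntegral_indicator_kernel {c : ℝ} (htt' : t ≤ t') :
    ∫ s in Ioo 0 t', (Iio t).indicator (fun s => c * ((t - s) ^ (β - 1) * f s)) s =
      c * abelIntegral β f t := by
  rw [setIntegral_indicator measurableSet_Iio, Ioo_inter_Iio, min_eq_right htt',
    integral_const_mul, abelIntegral]

theorem AbelIntegrable.integrable_indicator (hf : AbelIntegrable β f) (c : ℝ) (htt' : t ≤ t') :
    IntegrableOn ((Iio t).indicator fun s => c * ((t - s) ^ (β - 1) * f s)) (Ioo 0 t') := by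
  rw [IntegrableOn, integrable_indicator_iff measurableSet_Iio, IntegrableOn,
    Measure.restrict_restrict measurableSet_Iio, Iio_inter_Ioo, min_eq_left htt']
  rcases le_or_gt t 0 with ht | ht
  · rw [Ioo_eq_empty (not_lt.2 ht)]
    exact integrableOn_empty
  · exact (hf t ht).const_mul c

end KernelEstimates

namespace AbelWeight

variable {β δ t t' T E : ℝ} {f H C : ℝ → ℝ}

theorem bound_nonneg (hA : AbelWeight β δ H C) (ht : 0 < t) : 0 ≤ C t :=
  nonneg_of_mul_nonneg_left ((abelIntegral_nonneg fun s hs => hA.nonneg s hs.1).trans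
    (hA.abelIntegral_le t ht)) (Real.rpow_pos_of_pos ht _)

theorem rpow_mul_abelIntegral_le (hA : AbelWeight β δ H C) (hT : 0 < T) (ht : t ≤ T) :
    t ^ (1 - β) * abelIntegral (β - δ) H t ≤ C T * T ^ δ := by
  have hδ := hA.gain_pos
  rcases le_or_gt t 0 with h0 | h0
  · rw [abelIntegral_of_nonpos h0, mul_zero]
    exact mul_nonneg (hA.bound_nonneg hT) (Real.rpow_nonneg hT.le _)
  calc t ^ (1 - β) * abelIntegral (β - δ) H t ≤ t ^ (1 - β) * (C t * t ^ (β - 1 + δ)) :=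
        mul_le_mul_of_nonneg_left (hA.abelIntegral_le t h0) (Real.rpow_nonneg h0.le _)
    _ = C t * t ^ δ := by
        rw [mul_left_comm, ← Real.rpow_add h0]
        ring_nf
    _ ≤ C T * T ^ δ := by
        have := hA.bound_nonneg hT
        gcongr
        exact hA.monotone ht

theorem abs_weightedKernel_sub_indicator_le (hA : AbelWeight β δ H C) {s : ℝ} (hs : s ∈ Ioo 0 t')
    (htt' : t ≤ t') (hf : |f s| ≤ E * H s) :
    |t' ^ (1 - β) * ((t' - s) ^ (β - 1) * f s) -
        (Iio t).indicator (fun s => t ^ (1 - β) * ((t - s) ^ (β - 1) * f s)) s| ≤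
      (t' - t) ^ δ * E * (t' ^ (1 - β) * ((t' - s) ^ (β - δ - 1) * H s) +
        (Iio t).indicator (fun s => t ^ (1 - β) * ((t - s) ^ (β - δ - 1) * H s)) s) := by
  have hβ := hA.order_pos.le
  have hδ := hA.gain_pos.le
  have hEH : 0 ≤ E * H s := (abs_nonneg _).trans hf
  have ht' : 0 ≤ t' := hs.1.le.trans hs.2.le
  have hts' : 0 < t' - s := sub_pos.2 hs.2
  have hk' : 0 ≤ (t' - t) ^ δ * (t' ^ (1 - β) * (t' - s) ^ (β - δ - 1)) :=
    mul_nonneg (Real.rpow_nonneg (sub_nonneg.2 htt') _) (by positivity)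
  rcases lt_or_ge s t with hst | hst
  · have hk := weightedKernel_sub_le hβ hδ hA.gain_le_one hs.1.le hst htt'
    have hanti := weightedKernel_antitone hA.order_le_one hs.1.le hst htt'
    rw [indicator_of_mem (mem_Iio.2 hst), indicator_of_mem (mem_Iio.2 hst), ← mul_assoc,
      ← mul_assoc, ← sub_mul, abs_mul, abs_sub_comm, abs_of_nonneg (sub_nonneg.2 hanti)]
    calc _ ≤ (t' - t) ^ δ * (t ^ (1 - β) * (t - s) ^ (β - δ - 1)) * (E * H s) :=
          mul_le_mul hk hf (abs_nonneg _) ((sub_nonneg.2 hanti).trans hk)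
      _ ≤ _ := by linarith [mul_nonneg hk' hEH]
  · have hk := rpow_le_rpow_mul_rpow_sub (a := β - 1) hδ hts' (show t' - s ≤ t' - t by linarith)
    rw [indicator_of_notMem (notMem_Iio.2 hst), indicator_of_notMem (notMem_Iio.2 hst), sub_zero,
      add_zero, abs_mul, abs_mul, abs_of_nonneg (Real.rpow_nonneg ht' _),
      abs_of_nonneg (Real.rpow_nonneg hts'.le _)]
    calc t' ^ (1 - β) * ((t' - s) ^ (β - 1) * |f s|)
        ≤ t' ^ (1 - β) * ((t' - t) ^ δ * (t' - s) ^ (β - 1 - δ) * (E * H s)) := by gcongr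
      _ = _ := by rw [sub_right_comm]; ring

/- Since `t ^ (1 - β) * (t - s) ^ (β - 1) = (1 - s / t) ^ (β - 1)` decreases in `t`, the increment
of the kernel is controlled by a power of `t' - t` times a kernel that is more singular by `δ`. -/
theorem abs_weightedAbelIntegral_sub_le (hA : AbelWeight β δ H C) (hf : AbelIntegrable β f)
    (hE : 0 ≤ E) (hT : 0 < T) (hfH : ∀ s ∈ Ioo 0 T, |f s| ≤ E * H s) (htt' : t ≤ t')
    (ht' : t' ≤ T) :
    |weightedAbelIntegral β f t' - weightedAbelIntegral β f t| ≤
      2 * E * C T * T ^ δ * (t' - t) ^ δ := by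
  rcases le_or_gt t' 0 with h0 | h0
  · rw [weightedAbelIntegral_of_nonpos h0, weightedAbelIntegral_of_nonpos (htt'.trans h0), sub_self,
      abs_zero]
    have := hA.bound_nonneg hT
    have := sub_nonneg.2 htt'
    positivity
  have hHi := hA.abelIntegrable.integrable_indicator (t ^ (1 - β)) htt'
  have hHi' := (hA.abelIntegrable t' h0).const_mul (t' ^ (1 - β))
  have hsum : IntegrableOn (fun s => t' ^ (1 - β) * ((t' - s) ^ (β - δ - 1) * H s) +
      (Iio t).indicator (fun s => t ^ (1 - β) * ((t - s) ^ (β - δ - 1) * H s)) s) (Ioo 0 t') :=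
    hHi'.add hHi
  have hfi := hf.integrable_indicator (t ^ (1 - β)) htt'
  have hfi' := (hf t' h0).const_mul (t' ^ (1 - β))
  have hpow : 0 ≤ (t' - t) ^ δ := Real.rpow_nonneg (sub_nonneg.2 htt') _
  calc |weightedAbelIntegral β f t' - weightedAbelIntegral β f t|
      = |∫ s in Ioo 0 t', (t' ^ (1 - β) * ((t' - s) ^ (β - 1) * f s) -
          (Iio t).indicator (fun s => t ^ (1 - β) * ((t - s) ^ (β - 1) * f s)) s)| := by
        rw [integral_sub hfi' hfi, integral_const_mul, setIntegral_indicator_kernel htt']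
        rfl
    _ ≤ ∫ s in Ioo 0 t', (t' - t) ^ δ * E * (t' ^ (1 - β) * ((t' - s) ^ (β - δ - 1) * H s) +
          (Iio t).indicator (fun s => t ^ (1 - β) * ((t - s) ^ (β - δ - 1) * H s)) s) := by
        rw [← Real.norm_eq_abs]
        exact norm_integral_le_of_norm_le (hsum.const_mul _)
          (ae_restrict_of_forall_mem measurableSet_Ioo fun s hs =>
            hA.abs_weightedKernel_sub_indicator_le hs htt' (hfH s ⟨hs.1, hs.2.trans_le ht'⟩))
    _ = (t' - t) ^ δ * E * (t' ^ (1 - β) * abelIntegral (β - δ) H t' +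
          t ^ (1 - β) * abelIntegral (β - δ) H t) := by
        rw [integral_const_mul, integral_add hHi' hHi, integral_const_mul,
          setIntegral_indicator_kernel htt']
        rfl
    _ ≤ (t' - t) ^ δ * E * (C T * T ^ δ + C T * T ^ δ) :=
        mul_le_mul_of_nonneg_left (add_le_add (hA.rpow_mul_abelIntegral_le hT ht')
          (hA.rpow_mul_abelIntegral_le hT (htt'.trans ht'))) (mul_nonneg hpow hE)
    _ = _ := by ring

end AbelWeight

section Hoelder

variable {α β p q t : ℝ} {h : ℝ → ℝ}

theorem rpow_mul_rpow_rpow {x y : ℝ} (hx : 0 ≤ x) (hy : 0 ≤ y) :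
    (x ^ (α - 1) * y ^ (β - 1)) ^ q =
      x ^ ((α - 1) * q + 1 - 1) * y ^ ((β - 1) * q + 1 - 1) := by
  rw [Real.mul_rpow (Real.rpow_nonneg hx _) (Real.rpow_nonneg hy _), ← Real.rpow_mul hx,
    ← Real.rpow_mul hy, add_sub_cancel_right, add_sub_cancel_right]

theorem memLp_abelKernel (hq : 0 < q) (hα : 0 < (α - 1) * q + 1) (hβ : 0 < (β - 1) * q + 1)
    (ht : 0 < t) : MemLp (fun s => (t - s) ^ (α - 1) * s ^ (β - 1)) (ENNReal.ofReal q)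
      (volume.restrict (Ioo 0 t)) := by
  rw [← integrable_norm_rpow_iff (Measurable.aestronglyMeasurable (by fun_prop))
    (ENNReal.ofReal_pos.2 hq).ne' ENNReal.ofReal_ne_top, ENNReal.toReal_ofReal hq.le]
  refine IntegrableOn.congr_fun (abelIntegrable_rpow_sub_one hα hβ t ht) (fun s hs => ?_)
    measurableSet_Ioo
  have hts := sub_nonneg.2 hs.2.le
  rw [Real.norm_of_nonneg (mul_nonneg (Real.rpow_nonneg hts _) (Real.rpow_nonneg hs.1.le _)),
    rpow_mul_rpow_rpow hts hs.1.le]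

theorem integrableOn_abelKernel_mul (hqp : q.HolderConjugate p) (hα : 0 < (α - 1) * q + 1)
    (hβ : 0 < (β - 1) * q + 1) (ht : 0 < t)
    (hh : MemLp h (ENNReal.ofReal p) (volume.restrict (Ioo 0 t))) :
    IntegrableOn (fun s => (t - s) ^ (α - 1) * (s ^ (β - 1) * h s)) (Ioo 0 t) := by
  have : (ENNReal.ofReal q).HolderConjugate (ENNReal.ofReal p) := hqp.ennrealOfReal
  simp only [← mul_assoc]
  exact (memLp_abelKernel hqp.pos hα hβ ht).integrable_mul hh

theorem abelIntegral_rpow_mul_le (hqp : q.HolderConjugate p) (hα : 0 < (α - 1) * q + 1)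
    (hβ : 0 < (β - 1) * q + 1) (ht : 0 < t) (h0 : ∀ s ∈ Ioo 0 t, 0 ≤ h s)
    (hh : MemLp h (ENNReal.ofReal p) (volume.restrict (Ioo 0 t))) :
    abelIntegral α (fun s => s ^ (β - 1) * h s) t ≤
      (ProbabilityTheory.beta ((β - 1) * q + 1) ((α - 1) * q + 1) *
          t ^ ((α - 1) * q + 1 + ((β - 1) * q + 1) - 1)) ^ (1 / q) *
        (∫ s in Ioo 0 t, h s ^ p) ^ (1 / p) := by
  have hk0 : ∀ s ∈ Ioo 0 t, 0 ≤ (t - s) ^ (α - 1) * s ^ (β - 1) := fun s hs =>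
    mul_nonneg (Real.rpow_nonneg (sub_nonneg.2 hs.2.le) _) (Real.rpow_nonneg hs.1.le _)
  simp only [abelIntegral, ← mul_assoc]
  refine (integral_mul_le_Lp_mul_Lq_of_nonneg hqp
    (ae_restrict_of_forall_mem measurableSet_Ioo hk0)
    (ae_restrict_of_forall_mem measurableSet_Ioo h0)
    (memLp_abelKernel hqp.pos hα hβ ht) hh).trans ?_
  rw [← abelIntegral_rpow_sub_one hα hβ ht, abelIntegral,
    setIntegral_congr_fun measurableSet_Ioo fun s hs =>
      rpow_mul_rpow_rpow (sub_nonneg.2 hs.2.le) hs.1.le]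

theorem integrableOn_rpow_of_memLp (hp : 0 < p) (h0 : ∀ s ∈ Ioo 0 t, 0 ≤ h s)
    (hh : MemLp h (ENNReal.ofReal p) (volume.restrict (Ioo 0 t))) :
    IntegrableOn (fun s => h s ^ p) (Ioo 0 t) := by
  refine IntegrableOn.congr_fun (hh.integrable_norm_rpow (ENNReal.ofReal_pos.2 hp).ne'
    ENNReal.ofReal_ne_top) (fun s hs => ?_) measurableSet_Ioo
  rw [ENNReal.toReal_ofReal hp.le, Real.norm_of_nonneg (h0 s hs)]

theorem MemLpLoc.memLp_Ioo (hh : MemLpLoc p h) (t : ℝ) :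
    MemLp h (ENNReal.ofReal p) (volume.restrict (Ioo 0 t)) := by
  rcases le_or_gt t 0 with ht | ht
  · rw [Ioo_eq_empty (not_lt.2 ht), Measure.restrict_empty]
    exact memLp_measure_zero
  · exact (hh t ht).mono_measure (Measure.restrict_mono Ioo_subset_Icc_self le_rfl)

theorem MemLpLoc.monotone_integral_rpow (hh : MemLpLoc p h) (hp : 0 < p)
    (h0 : ∀ s, 0 < s → 0 ≤ h s) : Monotone fun t => ∫ s in Ioo 0 t, h s ^ p := fun _ t' htt' =>
  setIntegral_mono_set (integrableOn_rpow_of_memLp hp (fun s hs => h0 s hs.1) (hh.memLp_Ioo t'))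
    (ae_restrict_of_forall_mem measurableSet_Ioo fun s hs => Real.rpow_nonneg (h0 s hs.1) _)
    (Ioo_subset_Ioo_right htt').eventuallyLE

theorem exists_abelWeight_of_memLpLoc (hβ : 0 < β) (hβ1 : β ≤ 1) (hp : 1 / β < p)
    (hh : MemLpLoc p h) (h0 : ∀ s, 0 < s → 0 ≤ h s) :
    ∃ δ C, AbelWeight β δ (fun s => s ^ (β - 1) * h s) C := by
  have hp0 : 0 < p := (one_div_pos.2 hβ).trans hp
  have hpβ : 1 / p < β := (one_div_lt hβ hp0).1 hp
  have hqp : p.conjExponent.HolderConjugate p :=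
    (Real.HolderConjugate.conjExponent (((one_le_div hβ).2 hβ1).trans_lt hp)).symm
  set q := p.conjExponent
  have hq : 1 / q = 1 - 1 / p := by
    simp only [one_div]
    linarith [hqp.inv_add_inv_eq_one]
  have horder : ∀ a, 1 / p < a → 0 < (a - 1) * q + 1 := fun a ha => by
    have := mul_pos (show 0 < a - 1 + 1 / q by linarith) hqp.pos
    rwa [add_mul, one_div_mul_cancel hqp.pos.ne'] at this
  obtain ⟨δ, hδ, hδβ⟩ : ∃ δ, 0 < δ ∧ 2 * δ = β - 1 / p := ⟨(β - 1 / p) / 2, by linarith, by ring⟩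
  have hα := horder (β - δ) (by linarith)
  have hβ' := horder β hpβ
  set B := ProbabilityTheory.beta ((β - 1) * q + 1) ((β - δ - 1) * q + 1)
  have hB : 0 < B := ProbabilityTheory.beta_pos hβ' hα
  have hintegral : ∀ t, 0 ≤ ∫ s in Ioo 0 t, h s ^ p := fun t =>
    setIntegral_nonneg measurableSet_Ioo fun s hs => Real.rpow_nonneg (h0 s hs.1) _
  refine ⟨δ, fun t => B ^ (1 / q) * (∫ s in Ioo 0 t, h s ^ p) ^ (1 / p), hβ, hβ1, hδ, ?_,
    fun s hs => mul_nonneg (Real.rpow_nonneg hs.le _) (h0 s hs),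
    fun t ht => integrableOn_abelKernel_mul hqp hα hβ' ht (hh.memLp_Ioo t), fun t t' htt' => ?_,
    fun t ht => ?_⟩
  · linarith [one_div_pos.2 hp0]
  · exact mul_le_mul_of_nonneg_left (Real.rpow_le_rpow (hintegral t)
      (hh.monotone_integral_rpow hp0 h0 htt') (one_div_nonneg.2 hp0.le)) (Real.rpow_nonneg hB.le _)
  · refine (abelIntegral_rpow_mul_le hqp hα hβ' ht (fun s hs => h0 s hs.1)
      (hh.memLp_Ioo t)).trans_eq ?_
    have hexp : ((β - δ - 1) * q + 1 + ((β - 1) * q + 1) - 1) * (1 / q) = β - 1 + δ := by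
      linear_combination (2 * β - 2 - δ) * mul_one_div_cancel hqp.pos.ne' + hq - hδβ
    rw [Real.mul_rpow hB.le (Real.rpow_nonneg ht.le _), ← Real.rpow_mul ht.le, hexp]
    ring

end Hoelder

theorem tendsto_abelIntegral_of_dominated {β t : ℝ} {f : ℕ → ℝ → ℝ} {g H : ℝ → ℝ} (ht : 0 < t)
    (hH : AbelIntegrable β H)
    (hf : ∀ n, AEStronglyMeasurable (f n) (volume.restrict (Ioi 0)))
    (hfH : ∀ n, ∀ s ∈ Ioo 0 t, |f n s| ≤ H s)
    (hlim : ∀ s ∈ Ioo 0 t, Tendsto (fun n => f n s) atTop (𝓝 (g s))) :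
    Tendsto (fun n => abelIntegral β (f n) t) atTop (𝓝 (abelIntegral β g t)) := by
  refine tendsto_integral_of_dominated_convergence _ (fun n =>
    (Measurable.aestronglyMeasurable (by fun_prop)).mul
      ((hf n).mono_measure (Measure.restrict_mono Ioo_subset_Ioi_self le_rfl))) (hH t ht)
    (fun n => ae_restrict_of_forall_mem measurableSet_Ioo fun s hs => ?_)
    (ae_restrict_of_forall_mem measurableSet_Ioo fun s hs => (hlim s hs).const_mul _)
  have hk := Real.rpow_nonneg (sub_nonneg.2 hs.2.le) (β - 1)
  rw [norm_mul, Real.norm_of_nonneg hk]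
  exact mul_le_mul_of_nonneg_left (hfH n s hs) hk

theorem isCompact_closure_range_of_equicontinuous {X ι : Type*} [TopologicalSpace X]
    [CompactlyCoherentSpace X] {y : ι → C(X, ℝ)} (hy : Equicontinuous fun i x => y i x)
    (hb : ∀ x, ∃ E, ∀ i, |y i x| ≤ E) : IsCompact (closure (range y)) := by
  have : T2Space (UniformOnFun X ℝ {K | IsCompact K}) := UniformOnFun.t2Space_of_covering
    (eq_univ_of_forall fun _ => mem_sUnion_of_mem (mem_singleton _) isCompact_singleton)
  have hrange : Equicontinuous ((↑) : range y → X → ℝ) := by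
    convert hy.comp fun z : range y => z.2.choose using 2 with z
    exact congr_arg _ z.2.choose_spec.symm
  refine ArzelaAscoli.isCompact_closure_of_isClosedEmbedding (𝔖 := {K : Set X | IsCompact K})
    (F := fun (y : C(X, ℝ)) x => y x) (fun _ hK => hK)
    ContinuousMap.isUniformEmbedding_toUniformOnFunIsCompact.isClosedEmbedding
    (fun K _ => hrange.equicontinuousOn K) fun K _ x _ => ?_
  obtain ⟨E, hE⟩ := hb x
  exact ⟨Icc (-E) E, isCompact_Icc, forall_mem_range.2 fun i => abs_le.1 (hE i)⟩

/-- The operator `u ↦ x₀ + c * t ^ (1 - β) * ∫₀ᵗ (t - s) ^ (β - 1) * F s (u s) ds`, whose fixed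
points are the weighted unknowns `t ^ (1 - β) * x t`. It is constantly `x₀` for `t ≤ 0`. -/
noncomputable def volterraOp (β c x₀ : ℝ) (F : ℝ → ℝ → ℝ) (u : ℝ → ℝ) (t : ℝ) : ℝ :=
  x₀ + c * weightedAbelIntegral β (fun s => F s (u s)) t

/-- The data of a fixed point equation for `volterraOp β c x₀ F` whose nonlinearity `F` is
continuous, nonnegative and of at most linear growth with respect to an Abel weight `H`. -/
structure AbelVolterra (β δ c x₀ : ℝ) (H C : ℝ → ℝ) (F : ℝ → ℝ → ℝ) : Prop where
  weight : AbelWeight β δ H C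
  coeff_nonneg : 0 ≤ c
  init_nonneg : 0 ≤ x₀
  continuousOn : ContinuousOn (Function.uncurry F) (Ioi 0 ×ˢ Ici 0)
  nonneg : ∀ s u, 0 < s → 0 ≤ u → 0 ≤ F s u
  le : ∀ s u, 0 < s → 0 ≤ u → F s u ≤ H s * (1 + u)

/-- The nonnegative continuous functions that grow on each half-line `(-∞, T]` at most
exponentially with rate `Λ T`. For suitable `Λ` this class is invariant under `volterraOp`. -/
def expBounded (x₀ : ℝ) (Λ : ℝ → ℝ) : Set (ℝ → ℝ) :=
  {u | Continuous u ∧ (∀ t, 0 ≤ u t) ∧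
    ∀ T t, 0 < T → t ≤ T → 1 + u t ≤ (1 + x₀) * (1 + Real.exp (Λ T * t))}

/-- Rates `Λ T` of exponential growth so large that `volterraOp` preserves `expBounded x₀ Λ`. -/
def IsGrowthRate (δ c : ℝ) (C Λ : ℝ → ℝ) : Prop :=
  ∀ T, 0 < T → 0 < Λ T ∧ 2 * c * (C T * T ^ δ) * Λ T ^ (-δ) ≤ 1

theorem exists_isGrowthRate {δ : ℝ} (hδ : 0 < δ) (c : ℝ) (C : ℝ → ℝ) :
    ∃ Λ, IsGrowthRate δ c C Λ := by
  suffices h : ∀ T, ∃ r, 0 < r ∧ 2 * c * (C T * T ^ δ) * r ^ (-δ) ≤ 1 by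
    choose Λ hΛ using h
    exact ⟨Λ, fun T _ => hΛ T⟩
  intro T
  have hlim := (tendsto_rpow_neg_atTop hδ).const_mul (2 * c * (C T * T ^ δ))
  rw [mul_zero] at hlim
  exact ((eventually_gt_atTop 0).and (hlim.eventually_le_const one_pos)).exists

section VolterraOp

variable {β c x₀ t : ℝ} {F : ℝ → ℝ → ℝ} {u v : ℝ → ℝ}

theorem volterraOp_of_nonpos (ht : t ≤ 0) : volterraOp β c x₀ F u t = x₀ := by
  rw [volterraOp, weightedAbelIntegral_of_nonpos ht, mul_zero, add_zero]

theorem volterraOp_congr (h : EqOn u v (Ioo 0 t)) :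
    volterraOp β c x₀ F u t = volterraOp β c x₀ F v t := by
  rw [volterraOp, volterraOp, weightedAbelIntegral, weightedAbelIntegral,
    abelIntegral_congr (g := fun s => F s (v s)) fun s hs => by simp only [h hs]]

end VolterraOp

theorem const_mem_expBounded {x₀ : ℝ} (hx₀ : 0 ≤ x₀) (Λ : ℝ → ℝ) :
    (fun _ => x₀) ∈ expBounded x₀ Λ := by
  refine ⟨continuous_const, fun _ => hx₀, fun T t _ _ => ?_⟩
  exact le_mul_of_one_le_right (by linarith) (by linarith [Real.exp_pos (Λ T * t)])

theorem one_add_le_of_mem_expBounded {x₀ s T : ℝ} {Λ u : ℝ → ℝ} (hx₀ : 0 ≤ x₀)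
    (hu : u ∈ expBounded x₀ Λ) (hs : s ∈ Ioo 0 T) :
    1 + u s ≤ (1 + x₀) * (1 + Real.exp (|Λ T| * T)) := by
  refine (hu.2.2 T s (hs.1.trans hs.2) hs.2.le).trans ?_
  have hΛ : Λ T * s ≤ |Λ T| * T :=
    mul_le_mul (le_abs_self _) hs.2.le hs.1.le (abs_nonneg _)
  gcongr

namespace AbelVolterra

variable {β δ c x₀ t t' T E η : ℝ} {H C Λ : ℝ → ℝ} {F : ℝ → ℝ → ℝ} {u : ℝ → ℝ}

theorem abs_le (hV : AbelVolterra β δ c x₀ H C F) {s u : ℝ} (hs : 0 < s) (hu : 0 ≤ u)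
    (huE : 1 + u ≤ E) : |F s u| ≤ E * H s := by
  rw [abs_of_nonneg (hV.nonneg s u hs hu), mul_comm]
  exact (hV.le s u hs hu).trans (mul_le_mul_of_nonneg_left huE (hV.weight.nonneg s hs))

theorem continuousOn_comp (hV : AbelVolterra β δ c x₀ H C F) (hu : Continuous u)
    (hu0 : ∀ t, 0 ≤ u t) : ContinuousOn (fun s => F s (u s)) (Ioi 0) :=
  hV.continuousOn.comp (continuous_id.prodMk hu).continuousOn fun s hs => ⟨hs, hu0 s⟩

theorem abelIntegrable_comp (hV : AbelVolterra β δ c x₀ H C F) (hu : Continuous u)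
    (hu0 : ∀ t, 0 ≤ u t) : AbelIntegrable β fun s => F s (u s) := by
  refine (hV.weight.abelIntegrable.mono_exponent (sub_le_self β hV.weight.gain_pos.le)).mono
    ((hV.continuousOn_comp hu hu0).aestronglyMeasurable measurableSet_Ioi) fun t => ?_
  obtain ⟨E, hE⟩ := (isCompact_Icc (a := 0) (b := t)).exists_bound_of_continuousOn
    (continuous_const.add hu : Continuous fun s => 1 + u s).continuousOn
  exact ⟨E, fun s hs => hV.abs_le hs.1 (hu0 s) ((le_abs_self _).trans (hE s ⟨hs.1.le, hs.2.le⟩))⟩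

theorem volterraOp_nonneg (hV : AbelVolterra β δ c x₀ H C F) (hu0 : ∀ s, 0 ≤ u s) :
    0 ≤ volterraOp β c x₀ F u t := by
  rcases le_or_gt t 0 with ht | ht
  · exact (volterraOp_of_nonpos ht).symm ▸ hV.init_nonneg
  · exact add_nonneg hV.init_nonneg (mul_nonneg hV.coeff_nonneg (mul_nonneg
      (Real.rpow_nonneg ht.le _) (abelIntegral_nonneg fun s hs => hV.nonneg s _ hs.1 (hu0 s))))

theorem abs_volterraOp_sub_le (hV : AbelVolterra β δ c x₀ H C F) (hu : Continuous u)
    (hu0 : ∀ t, 0 ≤ u t) (hE : 0 ≤ E) (huE : ∀ s ∈ Ioo 0 T, 1 + u s ≤ E) (hT : 0 < T)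
    (ht : t ≤ T) (ht' : t' ≤ T) :
    |volterraOp β c x₀ F u t' - volterraOp β c x₀ F u t| ≤
      c * (2 * E * C T * T ^ δ) * |t' - t| ^ δ := by
  wlog htt' : t ≤ t' generalizing t t'
  · rw [abs_sub_comm, abs_sub_comm t']
    exact this ht' ht (le_of_not_ge htt')
  rw [volterraOp, volterraOp, add_sub_add_left_eq_sub, ← mul_sub, abs_mul,
    abs_of_nonneg hV.coeff_nonneg, abs_of_nonneg (sub_nonneg.2 htt'), mul_assoc]
  exact mul_le_mul_of_nonneg_left (hV.weight.abs_weightedAbelIntegral_sub_le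
    (hV.abelIntegrable_comp hu hu0) hE hT (fun s hs => hV.abs_le hs.1 (hu0 s) (huE s hs)) htt' ht')
    hV.coeff_nonneg

theorem equicontinuous_volterraOp (hV : AbelVolterra β δ c x₀ H C F) :
    Equicontinuous fun (u : expBounded x₀ Λ) => volterraOp β c x₀ F u := by
  intro t
  obtain ⟨T, hT0, htT⟩ : ∃ T, 0 < T ∧ t < T := ⟨|t| + 1, by positivity, by linarith [le_abs_self t]⟩
  set E := (1 + x₀) * (1 + Real.exp (|Λ T| * T))
  have hδ := hV.weight.gain_pos
  refine Metric.equicontinuousAt_of_continuity_modulus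
    (fun t' => c * (2 * E * C T * T ^ δ) * |t - t'| ^ δ) ?_ _ ?_
  · have hcont : Continuous fun t' => c * (2 * E * C T * T ^ δ) * |t - t'| ^ δ :=
      continuous_const.mul ((continuous_const.sub continuous_id).abs.rpow_const
        fun _ => Or.inr hδ.le)
    simpa only [sub_self, abs_zero, Real.zero_rpow hδ.ne', mul_zero] using hcont.tendsto t
  · filter_upwards [eventually_le_nhds htT] with t' ht' u
    have hE0 : 0 ≤ E := mul_nonneg (by linarith [hV.init_nonneg]) (by positivity)
    exact hV.abs_volterraOp_sub_le u.2.1 u.2.2.1 hE0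
      (fun s hs => one_add_le_of_mem_expBounded hV.init_nonneg u.2 hs) hT0 ht' htT.le

theorem one_add_volterraOp_le (hV : AbelVolterra β δ c x₀ H C F) (hΛ : IsGrowthRate δ c C Λ)
    (hu : u ∈ expBounded x₀ Λ) (hT : 0 < T) (ht : t ≤ T) :
    1 + volterraOp β c x₀ F u t ≤ (1 + x₀) * (1 + Real.exp (Λ T * t)) := by
  have hx := hV.init_nonneg
  have hc := hV.coeff_nonneg
  obtain ⟨hr, hΛT⟩ := hΛ T hT
  rcases le_or_gt t 0 with h0 | h0
  · rw [volterraOp_of_nonpos h0]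
    exact le_mul_of_one_le_right (by linarith) (by linarith [Real.exp_pos (Λ T * t)])
  have hFu : ∀ s ∈ Ioo 0 t, |F s (u s)| ≤ 2 * (1 + x₀) * H s * Real.exp (Λ T * s) := by
    intro s hs
    have hexp : 1 ≤ Real.exp (Λ T * s) := Real.one_le_exp (mul_nonneg hr.le hs.1.le)
    have hu1 : 1 + u s ≤ 2 * (1 + x₀) * Real.exp (Λ T * s) := by
      nlinarith [hu.2.2 T s hT (hs.2.le.trans ht)]
    exact (hV.abs_le hs.1 (hu.2.1 s) hu1).trans_eq (mul_right_comm _ _ _)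
  have hintegral := (le_abs_self _).trans (abs_abelIntegral_le_exp hV.weight.gain_pos.le
    hV.weight.gain_le_one hr hV.weight.abelIntegrable hFu)
  have hbound : c * weightedAbelIntegral β (fun s => F s (u s)) t ≤
      (1 + x₀) * Real.exp (Λ T * t) := by
    calc c * weightedAbelIntegral β (fun s => F s (u s)) t
        ≤ c * (t ^ (1 - β) * (Real.exp (Λ T * t) * Λ T ^ (-δ) * (2 * (1 + x₀)) *
            abelIntegral (β - δ) H t)) := by
          rw [weightedAbelIntegral]
          gcongr
      _ = (1 + x₀) * Real.exp (Λ T * t) *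
            (2 * c * (t ^ (1 - β) * abelIntegral (β - δ) H t) * Λ T ^ (-δ)) := by ring
      _ ≤ (1 + x₀) * Real.exp (Λ T * t) * (2 * c * (C T * T ^ δ) * Λ T ^ (-δ)) := by
          have := hV.weight.rpow_mul_abelIntegral_le hT ht
          gcongr (1 + x₀) * Real.exp (Λ T * t) * (2 * c * ?_ * _)
      _ ≤ (1 + x₀) * Real.exp (Λ T * t) := mul_le_of_le_one_right (by positivity) hΛT
  rw [volterraOp]
  linarith

theorem volterraOp_delay_mem (hV : AbelVolterra β δ c x₀ H C F) (hΛ : IsGrowthRate δ c C Λ)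
    (hu : u ∈ expBounded x₀ Λ) (hη : 0 ≤ η) :
    (fun t => volterraOp β c x₀ F u (t - η)) ∈ expBounded x₀ Λ := by
  refine ⟨(hV.equicontinuous_volterraOp.continuous ⟨u, hu⟩).comp (continuous_sub_right η),
    fun t => hV.volterraOp_nonneg hu.2.1, fun T t hT ht => ?_⟩
  have := hV.init_nonneg
  have := (hΛ T hT).1
  refine (hV.one_add_volterraOp_le hΛ hu hT ((sub_le_self t hη).trans ht)).trans ?_
  gcongr
  exact sub_le_self t hη

theorem volterraOp_mem (hV : AbelVolterra β δ c x₀ H C F) (hΛ : IsGrowthRate δ c C Λ)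
    (hu : u ∈ expBounded x₀ Λ) : volterraOp β c x₀ F u ∈ expBounded x₀ Λ := by
  simpa only [sub_zero] using hV.volterraOp_delay_mem hΛ hu le_rfl

/- With a delay `η`, the equation on `(-∞, (j + 1) * η]` only involves the values of the unknown
on `(-∞, j * η]`, so that the iterates of the operator are eventually constant at each time. -/
theorem exists_delayed_solution (hV : AbelVolterra β δ c x₀ H C F) (hΛ : IsGrowthRate δ c C Λ)
    (hη : 0 < η) (T : ℝ) :
    ∃ w ∈ expBounded x₀ Λ, ∀ t ≤ T, w t = volterraOp β c x₀ F w (t - η) := by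
  set V : (ℝ → ℝ) → ℝ → ℝ := fun u t => volterraOp β c x₀ F u (t - η)
  set v : ℕ → ℝ → ℝ := fun j => V^[j] fun _ => x₀
  have hsucc : ∀ j, v (j + 1) = V (v j) := fun j => Function.iterate_succ_apply' V j _
  have hmem : ∀ j, v j ∈ expBounded x₀ Λ := by
    intro j
    induction j with
    | zero => exact const_mem_expBounded hV.init_nonneg Λ
    | succ j ih => exact hsucc j ▸ hV.volterraOp_delay_mem hΛ ih hη.le
  have hstable : ∀ j : ℕ, ∀ t ≤ j * η, v j t = v (j + 1) t := by
    intro j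
    induction j with
    | zero =>
      intro t ht
      rw [Nat.cast_zero, zero_mul] at ht
      exact (volterraOp_of_nonpos (by linarith)).symm
    | succ j ih =>
      intro t ht
      rw [hsucc, hsucc (j + 1)]
      refine volterraOp_congr fun s hs => ih s ?_
      push_cast at ht
      linarith [hs.2]
  obtain ⟨j, hj⟩ := exists_nat_ge (T / η)
  exact ⟨v j, hmem j, fun t ht => (hstable j t (ht.trans ((div_le_iff₀ hη).1 hj))).trans
    (congr_fun (hsucc j) t)⟩

theorem tendsto_volterraOp (hV : AbelVolterra β δ c x₀ H C F) {v : ℕ → ℝ → ℝ}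
    (hv : ∀ n, v n ∈ expBounded x₀ Λ) (hlim : ∀ s, Tendsto (fun n => v n s) atTop (𝓝 (u s))) :
    Tendsto (fun n => volterraOp β c x₀ F (v n) t) atTop (𝓝 (volterraOp β c x₀ F u t)) := by
  rcases le_or_gt t 0 with ht | ht
  · simp only [volterraOp_of_nonpos ht, tendsto_const_nhds]
  have hdom := (hV.weight.abelIntegrable.mono_exponent
    (sub_le_self β hV.weight.gain_pos.le)).const_mul ((1 + x₀) * (1 + Real.exp (|Λ t| * t)))
  refine (((tendsto_abelIntegral_of_dominated ht hdom
    (fun n => (hV.continuousOn_comp (hv n).1 (hv n).2.1).aestronglyMeasurable measurableSet_Ioi)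
    (fun n s hs => hV.abs_le hs.1 ((hv n).2.1 s)
      (one_add_le_of_mem_expBounded hV.init_nonneg (hv n) hs))
    fun s hs => ?_).const_mul _).const_mul _).const_add _
  have hmem : ∀ᶠ n in atTop, (s, v n s) ∈ Ioi (0 : ℝ) ×ˢ Ici (0 : ℝ) :=
    Eventually.of_forall fun n => ⟨hs.1, (hv n).2.1 s⟩
  have hu0 : 0 ≤ u s := ge_of_tendsto' (hlim s) fun n => (hv n).2.1 s
  exact (hV.continuousOn (s, u s) ⟨hs.1, hu0⟩).tendsto.comp
    (tendsto_nhdsWithin_iff.2 ⟨tendsto_const_nhds.prodMk_nhds (hlim s), hmem⟩)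

theorem exists_fixedPoint (hV : AbelVolterra β δ c x₀ H C F) :
    ∃ u, Continuous u ∧ (∀ t, 0 ≤ u t) ∧ volterraOp β c x₀ F u = u := by
  obtain ⟨Λ, hΛ⟩ := exists_isGrowthRate hV.weight.gain_pos c C
  choose w hw hdelay using fun n : ℕ =>
    hV.exists_delayed_solution hΛ (Nat.one_div_pos_of_nat (α := ℝ) (n := n)) n
  set y : ℕ → C(ℝ, ℝ) := fun n => ⟨volterraOp β c x₀ F (w n), (hV.volterraOp_mem hΛ (hw n)).1⟩
  have hcompact : IsCompact (closure (range y)) := by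
    refine isCompact_closure_range_of_equicontinuous
      (hV.equicontinuous_volterraOp.comp fun n => ⟨w n, hw n⟩)
      fun t => ⟨(1 + x₀) * (1 + Real.exp (Λ (|t| + 1) * t)), fun n => ?_⟩
    obtain ⟨-, hpos, hexp⟩ := hV.volterraOp_mem hΛ (hw n)
    change |volterraOp β c x₀ F (w n) t| ≤ _
    rw [abs_of_nonneg (hpos t)]
    linarith [hexp (|t| + 1) t (by positivity) (by linarith [le_abs_self t])]
  obtain ⟨u, -, ψ, hψ, hy⟩ := hcompact.tendsto_subseq fun n => subset_closure (mem_range_self n)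
  have hwu : ∀ t, Tendsto (fun k => w (ψ k) t) atTop (𝓝 (u t)) := by
    intro t
    have hdelay0 : Tendsto (fun k => t - 1 / ((ψ k : ℝ) + 1)) atTop (𝓝 t) := by
      simpa only [sub_zero, Function.comp_def] using
        (tendsto_one_div_add_atTop_nhds_zero_nat.comp hψ.tendsto_atTop).const_sub t
    refine (hy.eval hdelay0).congr' ?_
    filter_upwards [(tendsto_natCast_atTop_atTop.comp hψ.tendsto_atTop).eventually_ge_atTop t]
      with k hk
    exact (hdelay (ψ k) t hk).symm
  exact ⟨u, u.continuous, fun t => ge_of_tendsto' (hwu t) fun k => (hw (ψ k)).2.1 t,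
    funext fun t => tendsto_nhds_unique (hV.tendsto_volterraOp (fun k => hw (ψ k)) hwu)
      (hy.eval_const t)⟩

end AbelVolterra

/-- A solution in `C⁺_{1-β}(0, ∞)` of the Abel integral equation
`x t = x₀ * t ^ (β - 1) + (1 / Γ(β)) * ∫₀ᵗ (t - s) ^ (β - 1) * f s ds`, the integrated form of
`D^β x = f` together with its initial condition. In the application `f` depends on `x`. -/
structure IsAbelSolution (β x₀ : ℝ) (f x : ℝ → ℝ) : Prop where
  mem_cPlusWeighted : x ∈ CPlusWeighted (1 - β)
  continuousOn : ContinuousOn f (Ioi 0)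
  abelIntegrable : AbelIntegrable β f
  eq : ∀ t, 0 < t → x t = x₀ * t ^ (β - 1) + 1 / Real.Gamma β * abelIntegral β f t
  initial : Tendsto (fun t => t ^ (1 - β) * x t) (𝓝[>] 0) (𝓝 x₀)

theorem continuousOn_rpow_const_Ioi (a : ℝ) : ContinuousOn (fun t : ℝ => t ^ a) (Ioi 0) :=
  fun t ht => (Real.continuousAt_rpow_const t a (Or.inl (ne_of_gt ht))).continuousWithinAt

theorem AbelVolterra.exists_isAbelSolution {β δ x₀ : ℝ} {H C : ℝ → ℝ} {F : ℝ → ℝ → ℝ}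
    (hV : AbelVolterra β δ (1 / Real.Gamma β) x₀ H C F) :
    ∃ u : ℝ → ℝ, IsAbelSolution β x₀ (fun s => F s (u s)) fun t => t ^ (β - 1) * u t := by
  obtain ⟨u, hu, hu0, hfix⟩ := hV.exists_fixedPoint
  have hinv : ∀ t : ℝ, 0 < t → t ^ (1 - β) * t ^ (β - 1) = 1 := fun t ht => by
    rw [← Real.rpow_add ht, sub_add_sub_cancel, sub_self, Real.rpow_zero]
  have hweight : ∀ t, 0 < t → u t = t ^ (1 - β) * (t ^ (β - 1) * u t) := fun t ht => by
    rw [← mul_assoc, hinv t ht, one_mul]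
  have hux₀ : u 0 = x₀ := by rw [← hfix, volterraOp_of_nonpos le_rfl]
  refine ⟨u, ⟨(continuousOn_rpow_const_Ioi _).mul hu.continuousOn,
    fun t ht => mul_nonneg (Real.rpow_nonneg ht.le _) (hu0 t),
    u, hu.continuousOn, fun t _ => hu0 t, hweight⟩,
    hV.continuousOn_comp hu hu0, hV.abelIntegrable_comp hu hu0, fun t ht => ?_, ?_⟩
  · have heq :
        x₀ + 1 / Real.Gamma β * (t ^ (1 - β) * abelIntegral β (fun s => F s (u s)) t) = u t :=
      congr_fun hfix t
    linear_combination (-t ^ (β - 1)) * heq +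
      1 / Real.Gamma β * abelIntegral β (fun s => F s (u s)) t * hinv t ht
  · rw [← hux₀]
    refine (hu.continuousAt.tendsto.mono_left nhdsWithin_le_nhds).congr' ?_
    filter_upwards [self_mem_nhdsWithin] with t ht using hweight t ht

theorem abelIntegrable_of_mem_cPlusWeighted {α β : ℝ} {x : ℝ → ℝ} (hα : 0 < α) (hβ : 0 < β)
    (hx : x ∈ CPlusWeighted (1 - β)) : AbelIntegrable α x := by
  obtain ⟨hxc, -, g, hgc, -, hg⟩ := hx
  refine (abelIntegrable_rpow_sub_one hα hβ).mono
    (hxc.aestronglyMeasurable measurableSet_Ioi) fun t => ?_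
  obtain ⟨E, hE⟩ := (isCompact_Icc (a := 0) (b := t)).exists_bound_of_continuousOn
    (hgc.mono Icc_subset_Ici_self)
  refine ⟨E, fun s hs => ?_⟩
  have hxs : x s = g s * s ^ (β - 1) := by
    rw [hg s hs.1, mul_right_comm, ← Real.rpow_add hs.1, sub_add_sub_cancel, sub_self,
      Real.rpow_zero, one_mul]
  have hpow := Real.rpow_nonneg hs.1.le (β - 1)
  rw [hxs, abs_mul, abs_of_nonneg hpow]
  exact mul_le_mul_of_nonneg_right (hE s ⟨hs.1.le, hs.2.le⟩) hpow

namespace IsAbelSolution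

variable {β x₀ b t : ℝ} {f x : ℝ → ℝ}

theorem intervalIntegrable (hx : IsAbelSolution β x₀ f x) (hβ1 : β ≤ 1) (ht : 0 < t) :
    IntervalIntegrable f volume 0 t :=
  (intervalIntegrable_iff_integrableOn_Ioo_of_le ht.le).2 (hx.abelIntegrable.integrableOn hβ1 ht)

theorem rlIntegral_one_sub (hx : IsAbelSolution β x₀ f x) (hβ : 0 < β) (hβ1 : β < 1)
    (ht : 0 < t) :
    rlIntegral (1 - β) x t = x₀ * Real.Gamma β + ∫ s in (0 : ℝ)..t, f s := by
  have hα : 0 < 1 - β := sub_pos.2 hβ1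
  have hdiff : abelIntegral (1 - β) (fun s => 1 / Real.Gamma β * abelIntegral β f s) t =
      abelIntegral (1 - β) x t + -x₀ * ProbabilityTheory.beta β (1 - β) := by
    rw [abelIntegral_congr (g := fun s => x s + -x₀ * s ^ (β - 1)) fun s hs => by
        linear_combination -hx.eq s hs.1,
      abelIntegral_add (abelIntegrable_of_mem_cPlusWeighted hα hβ hx.mem_cPlusWeighted)
        ((abelIntegrable_rpow_sub_one hα hβ).const_mul _),
      abelIntegral_const_mul, abelIntegral_rpow_sub_one hα hβ ht, sub_add_cancel, sub_self,
      Real.rpow_zero, mul_one]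
  rw [abelIntegral_const_mul, abelIntegral_abelIntegral hα hβ hx.abelIntegrable, sub_add_cancel,
    abelIntegral_one, ProbabilityTheory.beta, add_sub_cancel, Real.Gamma_one, div_one] at hdiff
  rw [rlIntegral_eq ht.le, intervalIntegral.integral_of_le ht.le, integral_Ioc_eq_integral_Ioo]
  have hΓβ := (Real.Gamma_pos_of_pos hβ).ne'
  have hΓα := (Real.Gamma_pos_of_pos hα).ne'
  field_simp at hdiff ⊢
  linear_combination -hdiff

theorem isRLSolution {l k φ : ℝ → ℝ}
    (hx : IsAbelSolution β x₀ (fun t => l t * φ (x t) + k t) x) (hβ : 0 < β) (hβ1 : β < 1) :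
    IsRLSolution β x₀ l k φ x where
  integrableOn T hT := by
    rw [integrableOn_Ioc_iff_integrableOn_Ioo]
    exact (abelIntegrable_of_mem_cPlusWeighted one_pos hβ hx.mem_cPlusWeighted).integrableOn
      le_rfl hT
  absCont T hT :=
    ⟨_, (LipschitzWith.const (x₀ * Real.Gamma β)).lipschitzOnWith.absolutelyContinuousOnInterval.add
      ((hx.intervalIntegrable hβ1.le hT).absolutelyContinuousOnInterval_intervalIntegral
        left_mem_uIcc), fun _ ht => (hx.rlIntegral_one_sub hβ hβ1 ht.1).symm⟩
  equation t ht := by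
    refine ((intervalIntegral.integral_hasDerivAt_right (hx.intervalIntegrable hβ1.le ht)
      (hx.continuousOn.stronglyMeasurableAtFilter isOpen_Ioi t ht)
      (hx.continuousOn.continuousAt (Ioi_mem_nhds ht))).const_add
        (x₀ * Real.Gamma β)).congr_of_eventuallyEq ?_
    filter_upwards [Ioi_mem_nhds ht] with s hs using hx.rlIntegral_one_sub hβ hβ1 hs
  initial := hx.initial

theorem tendsto_atTop (hx : IsAbelSolution β x₀ f x) (hβ : 0 < β) (hβ1 : β < 1)
    (hf : Tendsto (fun t => t ^ β * f t) atTop (𝓝 b)) :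
    Tendsto x atTop (𝓝 (b * Real.pi / (Real.Gamma β * Real.sin (β * Real.pi)))) := by
  have hpow : Tendsto (fun t : ℝ => x₀ * t ^ (β - 1)) atTop (𝓝 0) := by
    simpa only [neg_sub, mul_zero] using
      (tendsto_rpow_neg_atTop (sub_pos.2 hβ1)).const_mul x₀
  have hlim := hpow.add
    ((tendsto_abelIntegral_atTop hβ hβ1 hx.abelIntegrable hf).const_mul (1 / Real.Gamma β))
  have hvalue : 0 + 1 / Real.Gamma β * (b * ProbabilityTheory.beta (1 - β) β) =
      b * Real.pi / (Real.Gamma β * Real.sin (β * Real.pi)) := by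
    rw [beta_one_sub_self, mul_comm Real.pi β]
    ring
  rw [hvalue] at hlim
  refine hlim.congr' ?_
  filter_upwards [eventually_gt_atTop 0] with t ht using (hx.eq t ht).symm

theorem exists_eventually_le (hx : IsAbelSolution β x₀ f x) (hβ : 0 < β) (hβ1 : β < 1)
    (hx₀ : 0 ≤ x₀)
    (hf : ∀ η, 0 < η → ∃ C, ∀ᶠ s in atTop, |f s| ≤ (η * x s + C) * s ^ (-β)) :
    ∃ B, ∀ᶠ t in atTop, x t ≤ B := by
  refine exists_eventually_le_of_le_abelIntegral (a := x₀) hβ hβ1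
    (one_div_pos.2 (Real.Gamma_pos_of_pos hβ)).le hx.mem_cPlusWeighted.1 hx.mem_cPlusWeighted.2.1
    hx.abelIntegrable ?_ hf
  filter_upwards [eventually_ge_atTop 1] with t ht
  rw [hx.eq t (one_pos.trans_le ht)]
  have hpow : t ^ (β - 1) ≤ 1 := Real.rpow_le_one_of_one_le_of_nonpos ht (by linarith)
  have := mul_le_of_le_one_right hx₀ hpow
  linarith

end IsAbelSolution

section Sublinear

variable {β μ p M b x₀ : ℝ} {l k φ x : ℝ → ℝ}

theorem rpow_le_one_add {u : ℝ} (hu : 0 ≤ u) (hμ0 : 0 ≤ μ) (hμ1 : μ ≤ 1) : u ^ μ ≤ 1 + u := by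
  calc u ^ μ ≤ (1 + u) ^ μ := Real.rpow_le_rpow hu (by linarith) hμ0
    _ ≤ (1 + u) ^ (1 : ℝ) := Real.rpow_le_rpow_of_exponent_le (by linarith) hμ1
    _ = 1 + u := Real.rpow_one _

theorem nonneg_of_abs_le_mul_rpow (hφM : ∀ u, 0 ≤ u → |φ u| ≤ M * u ^ μ) : 0 ≤ M := by
  simpa only [Real.one_rpow, mul_one] using (abs_nonneg _).trans (hφM 1 zero_le_one)

theorem le_mul_one_add_of_abs_le_mul_rpow (hμ0 : 0 ≤ μ) (hμ1 : μ ≤ 1)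
    (hφM : ∀ u, 0 ≤ u → |φ u| ≤ M * u ^ μ) {u : ℝ} (hu : 0 ≤ u) : φ u ≤ M * (1 + u) :=
  (le_abs_self _).trans ((hφM u hu).trans (mul_le_mul_of_nonneg_left
    (rpow_le_one_add hu hμ0 hμ1) (nonneg_of_abs_le_mul_rpow hφM)))

theorem continuousOn_of_rpow_mul {a : ℝ} {f : ℝ → ℝ}
    (hf : ContinuousOn (fun t => t ^ a * f t) (Ioi 0)) : ContinuousOn f (Ioi 0) := by
  refine ((continuousOn_rpow_const_Ioi (-a)).mul hf).congr fun t ht => ?_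
  rw [Pi.mul_apply, ← mul_assoc, ← Real.rpow_add ht, neg_add_cancel, Real.rpow_zero, one_mul]

theorem sublinear_field_le {s u : ℝ} (hμ0 : 0 ≤ μ) (hμ1 : μ ≤ 1) (hs : 0 < s)
    (hu : 0 ≤ u) (hl : 0 ≤ l s) (hk : 0 ≤ k s) (hφM : ∀ u, 0 ≤ u → |φ u| ≤ M * u ^ μ) :
    l s * φ (s ^ (β - 1) * u) + k s ≤
      s ^ (β - 1) * (M * (s ^ ((1 - μ) * (1 - β)) * l s) + s ^ (1 - β) * k s) * (1 + u) := by
  have hpow := Real.rpow_nonneg hs.le (β - 1)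
  have hφu : φ (s ^ (β - 1) * u) ≤ M * (s ^ ((β - 1) * μ) * (1 + u)) := by
    refine (le_abs_self _).trans ((hφM _ (mul_nonneg hpow hu)).trans ?_)
    rw [Real.mul_rpow hpow hu, ← Real.rpow_mul hs.le]
    have hM := nonneg_of_abs_le_mul_rpow hφM
    have := rpow_le_one_add hu hμ0 hμ1
    gcongr
  have hlexp : s ^ (β - 1) * s ^ ((1 - μ) * (1 - β)) = s ^ ((β - 1) * μ) := by
    rw [← Real.rpow_add hs]
    ring_nf
  have hkexp : s ^ (β - 1) * s ^ (1 - β) = 1 := by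
    rw [← Real.rpow_add hs, sub_add_sub_cancel, sub_self, Real.rpow_zero]
  calc l s * φ (s ^ (β - 1) * u) + k s
      ≤ l s * (M * (s ^ ((β - 1) * μ) * (1 + u))) + k s * (1 + u) := by
        gcongr
        exact le_mul_of_one_le_right hk (le_add_of_nonneg_right hu)
    _ = _ := by linear_combination (-(M * l s * (1 + u))) * hlexp - k s * (1 + u) * hkexp

theorem exists_abelVolterra_of_sublinear
    (hβ : 0 < β) (hβ1 : β ≤ 1) (hμ0 : 0 ≤ μ) (hμ1 : μ ≤ 1) (hp : 1 / β < p) (hx₀ : 0 ≤ x₀)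
    (hl0 : ∀ t, 0 < t → 0 ≤ l t)
    (hlc : ContinuousOn (fun t => t ^ ((1 - μ) * (1 - β)) * l t) (Ioi 0))
    (hlp : MemLpLoc p fun t => t ^ ((1 - μ) * (1 - β)) * l t)
    (hk0 : ∀ t, 0 < t → 0 ≤ k t)
    (hkc : ContinuousOn (fun t => t ^ (1 - β) * k t) (Ioi 0))
    (hkp : MemLpLoc p fun t => t ^ (1 - β) * k t)
    (hφc : ContinuousOn φ (Ici 0)) (hφ0 : ∀ u, 0 ≤ u → 0 ≤ φ u)
    (hφM : ∀ u, 0 ≤ u → |φ u| ≤ M * u ^ μ) :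
    ∃ δ H C, AbelVolterra β δ (1 / Real.Gamma β) x₀ H C
      fun s u => l s * φ (s ^ (β - 1) * u) + k s := by
  have hM := nonneg_of_abs_le_mul_rpow hφM
  obtain ⟨δ, C, hw⟩ := exists_abelWeight_of_memLpLoc hβ hβ1 hp
    (fun T hT => ((hlp T hT).const_mul M).add (hkp T hT)) fun s hs => by
      have := hl0 s hs
      have := hk0 s hs
      change 0 ≤ M * (s ^ ((1 - μ) * (1 - β)) * l s) + s ^ (1 - β) * k s
      positivity
  have hunweight : ∀ s u : ℝ, 0 < s → 0 ≤ u → 0 ≤ s ^ (β - 1) * u := fun s u hs hu =>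
    mul_nonneg (Real.rpow_nonneg hs.le _) hu
  refine ⟨δ, _, C, hw, (one_div_pos.2 (Real.Gamma_pos_of_pos hβ)).le, hx₀, ?_,
    fun s u hs hu => add_nonneg (mul_nonneg (hl0 s hs) (hφ0 _ (hunweight s u hs hu))) (hk0 s hs),
    fun s u hs hu => sublinear_field_le hμ0 hμ1 hs hu (hl0 s hs) (hk0 s hs) hφM⟩
  have hfst : MapsTo Prod.fst (Ioi (0 : ℝ) ×ˢ Ici (0 : ℝ)) (Ioi 0) := fun _ h => h.1
  exact (((continuousOn_of_rpow_mul hlc).comp continuousOn_fst hfst).mul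
    (hφc.comp (((continuousOn_rpow_const_Ioi _).comp continuousOn_fst hfst).mul continuousOn_snd)
      fun z hz => hunweight z.1 z.2 hz.1 hz.2)).add
    ((continuousOn_of_rpow_mul hkc).comp continuousOn_fst hfst)

theorem exists_sublinear_field_le (hl0 : ∀ t, 0 < t → 0 ≤ l t) (hk0 : ∀ t, 0 < t → 0 ≤ k t)
    (hφ0 : ∀ u, 0 ≤ u → 0 ≤ φ u) (hφM : ∀ u, 0 ≤ u → φ u ≤ M * (1 + u))
    (hx : ∀ t, 0 < t → 0 ≤ x t) (hl : Tendsto (fun t => t ^ β * l t) atTop (𝓝 0))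
    (hk : Tendsto (fun t => t ^ β * k t) atTop (𝓝 b)) {η : ℝ} (hη : 0 < η) :
    ∃ C, ∀ᶠ s in atTop, |l s * φ (x s) + k s| ≤ (η * x s + C) * s ^ (-β) := by
  have hlM : Tendsto (fun t => t ^ β * l t * M) atTop (𝓝 0) := by
    simpa only [zero_mul] using hl.mul_const M
  refine ⟨η + (b + 1), ?_⟩
  filter_upwards [hlM.eventually_le_const hη, hk.eventually_le_const (lt_add_one b),
    eventually_gt_atTop 0] with s hls hks hs
  have hxs := hx s hs
  have hls0 := hl0 s hs
  rw [abs_of_nonneg (add_nonneg (mul_nonneg hls0 (hφ0 _ hxs)) (hk0 s hs)), Real.rpow_neg hs.le,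
    ← div_eq_mul_inv, le_div_iff₀' (Real.rpow_pos_of_pos hs β)]
  calc s ^ β * (l s * φ (x s) + k s)
      ≤ s ^ β * (l s * (M * (1 + x s)) + k s) := by
        have := hφM _ hxs
        gcongr
    _ = s ^ β * l s * M * (1 + x s) + s ^ β * k s := by ring
    _ ≤ η * (1 + x s) + (b + 1) := by gcongr
    _ = η * x s + (η + (b + 1)) := by ring

theorem tendsto_rpow_mul_sublinear_field {B : ℝ} (hl0 : ∀ t, 0 < t → 0 ≤ l t)
    (hφ0 : ∀ u, 0 ≤ u → 0 ≤ φ u) (hφM : ∀ u, 0 ≤ u → φ u ≤ M * (1 + u))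
    (hx : ∀ t, 0 < t → 0 ≤ x t) (hl : Tendsto (fun t => t ^ β * l t) atTop (𝓝 0))
    (hk : Tendsto (fun t => t ^ β * k t) atTop (𝓝 b)) (hB : ∀ᶠ t in atTop, x t ≤ B) :
    Tendsto (fun t => t ^ β * (l t * φ (x t) + k t)) atTop (𝓝 b) := by
  have hM : 0 ≤ M := by
    simpa only [add_zero, mul_one] using (hφ0 0 le_rfl).trans (hφM 0 le_rfl)
  have hbound : Tendsto (fun t => t ^ β * l t * (M * (1 + B))) atTop (𝓝 0) := by
    simpa only [zero_mul] using hl.mul_const (M * (1 + B))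
  have hzero : Tendsto (fun t => t ^ β * l t * φ (x t)) atTop (𝓝 0) := by
    refine tendsto_of_tendsto_of_tendsto_of_le_of_le' tendsto_const_nhds hbound ?_ ?_
    · filter_upwards [eventually_gt_atTop 0] with t ht
      exact mul_nonneg (mul_nonneg (Real.rpow_nonneg ht.le _) (hl0 t ht)) (hφ0 _ (hx t ht))
    · filter_upwards [eventually_gt_atTop 0, hB] with t ht htB
      have hφB : φ (x t) ≤ M * (1 + B) := (hφM _ (hx t ht)).trans (by gcongr)
      exact mul_le_mul_of_nonneg_left hφB (mul_nonneg (Real.rpow_nonneg ht.le _) (hl0 t ht))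
  simpa only [zero_add, mul_add, mul_assoc] using hzero.add hk

theorem tendsto_rpow_mul_zero_of_rpow_mul_le {γ K : ℝ} (hβγ : β < γ)
    (hl0 : ∀ t, 0 < t → 0 ≤ l t) (hl : ∀ t, 1 ≤ t → t ^ γ * l t ≤ K) :
    Tendsto (fun t => t ^ β * l t) atTop (𝓝 0) := by
  have hdecay : Tendsto (fun t : ℝ => t ^ (-(γ - β)) * K) atTop (𝓝 0) := by
    simpa only [zero_mul] using (tendsto_rpow_neg_atTop (sub_pos.2 hβγ)).mul_const K
  refine tendsto_of_tendsto_of_tendsto_of_le_of_le' tendsto_const_nhds hdecay ?_ ?_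
  · filter_upwards [eventually_gt_atTop 0] with t ht
      using mul_nonneg (Real.rpow_nonneg ht.le _) (hl0 t ht)
  · filter_upwards [eventually_ge_atTop 1] with t ht
    have ht0 : 0 < t := one_pos.trans_le ht
    calc t ^ β * l t = t ^ (-(γ - β)) * (t ^ γ * l t) := by
          rw [← mul_assoc, ← Real.rpow_add ht0, neg_sub, sub_add_cancel]
      _ ≤ t ^ (-(γ - β)) * K := mul_le_mul_of_nonneg_left (hl t ht) (Real.rpow_nonneg ht0.le _)

end Sublinear

theorem theorem3p6_general
    (β μ p x₀ M b : ℝ) (l k φ : ℝ → ℝ)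
    (hβ : 0 < β) (hβ1 : β < 1)
    (hμ0 : 0 ≤ μ) (hμ1 : μ ≤ 1)
    (hp : 1 / β < p) (hx₀ : 0 ≤ x₀)
    (hl0 : ∀ t : ℝ, 0 < t → 0 ≤ l t)
    (hlc : ContinuousOn (fun t : ℝ => t ^ ((1 - μ) * (1 - β)) * l t) (Ioi 0))
    (hlp : MemLpLoc p (fun t : ℝ => t ^ ((1 - μ) * (1 - β)) * l t))
    (hlβ : Tendsto (fun t : ℝ => t ^ β * l t) atTop (𝓝 0))
    (hk0 : ∀ t : ℝ, 0 < t → 0 ≤ k t)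
    (hkc : ContinuousOn (fun t : ℝ => t ^ (1 - β) * k t) (Ioi 0))
    (hkp : MemLpLoc p (fun t : ℝ => t ^ (1 - β) * k t))
    (hkb : Tendsto (fun t : ℝ => t ^ β * k t) atTop (𝓝 b))
    (hφc : ContinuousOn φ (Ici 0)) (hφ0 : ∀ u : ℝ, 0 ≤ u → 0 ≤ φ u)
    (hφM : ∀ u : ℝ, 0 ≤ u → |φ u| ≤ M * u ^ μ) :
    ∃ x : ℝ → ℝ, x ∈ CPlusWeighted (1 - β) ∧ IsRLSolution β x₀ l k φ x ∧
      Tendsto x atTop (𝓝 (b * Real.pi / (Real.Gamma β * Real.sin (β * Real.pi)))) := by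
  obtain ⟨δ, H, C, hV⟩ := exists_abelVolterra_of_sublinear hβ hβ1.le hμ0 hμ1 hp hx₀ hl0 hlc hlp
    hk0 hkc hkp hφc hφ0 hφM
  obtain ⟨u, hx⟩ := hV.exists_isAbelSolution
  have hx0 := hx.mem_cPlusWeighted.2.1
  have hφle := fun u (hu : 0 ≤ u) => le_mul_one_add_of_abs_le_mul_rpow hμ0 hμ1 hφM hu
  obtain ⟨B, hB⟩ := hx.exists_eventually_le hβ hβ1 hx₀ fun η hη =>
    exists_sublinear_field_le hl0 hk0 hφ0 hφle hx0 hlβ hkb hη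
  exact ⟨_, hx.mem_cPlusWeighted, hx.isRLSolution hβ hβ1, hx.tendsto_atTop hβ hβ1
    (tendsto_rpow_mul_sublinear_field hl0 hφ0 hφle hx0 hlβ hkb hB)⟩

theorem theorem3p6
    (β γ μ p x₀ K M b : ℝ) (l k φ : ℝ → ℝ)
    (hβ : 0 < β) (hβγ : β < γ) (hγ : γ < 1)
    (hμ0 : 0 ≤ μ) (hμ1 : μ ≤ 1)
    (hp : 1 / β < p) (hx₀ : 0 < x₀)
    (hl0 : ∀ t : ℝ, 0 < t → 0 ≤ l t)
    (hlc : ContinuousOn (fun t : ℝ => t ^ ((1 - μ) * (1 - β)) * l t) (Ioi 0))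
    (hlp : MemLpLoc p (fun t : ℝ => t ^ ((1 - μ) * (1 - β)) * l t))
    (hK : 0 ≤ K) (hlK : ∀ t : ℝ, 1 ≤ t → t ^ γ * l t ≤ K)
    (hk0 : ∀ t : ℝ, 0 < t → 0 ≤ k t)
    (hkc : ContinuousOn (fun t : ℝ => t ^ (1 - β) * k t) (Ioi 0))
    (hkp : MemLpLoc p (fun t : ℝ => t ^ (1 - β) * k t))
    (hb : 0 ≤ b) (hkb : Tendsto (fun t : ℝ => t ^ β * k t) atTop (𝓝 b))
    (hφc : ContinuousOn φ (Ici 0)) (hφ0 : ∀ u : ℝ, 0 ≤ u → 0 ≤ φ u)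
    (hM : 0 ≤ M) (hφM : ∀ u : ℝ, 0 ≤ u → |φ u| ≤ M * u ^ μ) :
    ∃ x : ℝ → ℝ, x ∈ CPlusWeighted (1 - β) ∧ IsRLSolution β x₀ l k φ x ∧
      Tendsto x atTop (𝓝 (b * Real.pi / (Real.Gamma β * Real.sin (β * Real.pi)))) := by
  exact theorem3p6_general β μ p x₀ M b l k φ hβ (hβγ.trans hγ) hμ0 hμ1 hp hx₀.le hl0 hlc hlp
    (tendsto_rpow_mul_zero_of_rpow_mul_le hβγ hl0 hlK) hk0 hkc hkp hkb hφc hφ0 hφM
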